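/- Let $\mathcal D_{\mathrm{Cl}}(n,d)$ be the set of distributions $P(x)=|\langle x|U|0^n\rangle|^2$ on $\{0,1\}^n=\mathbb F_2^n$, where $U$ is the unitary of an $n$-qubit one-dimensional nearest-neighbour circuit of depth $d$ whose gates are one- or two-qubit Clifford unitaries (unitaries that conjugate the Pauli group into itself). (1) The classes $\mathcal D_{\mathrm{Cl}}(n)=\bigcup_{d}\mathcal D_{\mathrm{Cl}}(n,d)$ (hence the Clifford circuit distributions of any depth) are efficiently learnable from samples, both with respect to generators and with respect to evaluators. That is, for either kind of representation there is a single algorithm which, for all $n$, all $\varepsilon,\delta\in(0,1)$ and every $P\in\mathcal D_{\mathrm{Cl}}(n)$, given $n$, $\lceil 1/\varepsilon\rceil$, $\lceil 1/\delta\rceil$ and access to independent samples from $P$, always halts within $\mathrm{poly}(n,1/\varepsilon,1/\delta)$ steps and outputs with probability at least $1-\delta$ the code of a program that is a generator (a randomized program whose output has law $Q$), respectively an evaluator (a program computing $x\mapsto Q(x)$ exactly), of a distribution $Q$ on $\{0,1\}^n$ with $\mathrm{TV}(P,Q)=\frac12\sum_x|P(x)-Q(x)|<\varepsilon$, the program running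 in time $\mathrm{poly}(n)$. (2) Every $P\in\mathcal D_{\mathrm{Cl}}(n,d)$ is the uniform distribution on a non-empty affine subspace $A\subseteq\mathbb F_2^n$: $P(x)=2^{-\dim A}$ for $x\in A$ and $P(x)=0$ otherwise. (3) Gaussian elimination recovers this subspace: there is an algorithm which, given $n$, $\lceil 1/\delta\rceil$ with $\delta\in(0,1)$ and access to samples, always halts in time $\mathrm{poly}(n,1/\delta)$, takes exactly $k=n+1+\lceil\log_2(1/\delta)\rceil$ samples $x_1,\dots,x_k$, and outputs $(R,x_1)$, where the columns of the matrix $R$ are a maximal linearly independent subfamily of $x_1+x_1,\dots,x_k+x_1$; and whenever the samples are independent and uniform on a non-empty affine subspace $A\subseteq\mathbb F_2^n$, then with probability at least $1-\delta$ the output $(R,t)$ parametrizes $A$, that is, $R$ has full column rank and $A=\{Rb+t : b\in\mathbb F_2^m\}$, where $m$ is the number of columns of $R$. Algorithms and programs are those of a unit-cost random access machine with addition and truncated subtraction, coin flips and a sample oracle. -/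

import Mathlib

open MeasureTheory

/-! ## Bit strings and distributions -/

/-- Bit strings of length `n`, as vectors over the field with two elements. -/
abbrev Bits (n : ℕ) : Type := Fin n → ZMod 2

/-- Total variation distance of two distributions on bit strings. -/
noncomputable def tvDist {n : ℕ} (P Q : PMF (Bits n)) : ℝ :=
  (1 / 2) * ∑ x, |(P x).toReal - (Q x).toReal|

/-- `P` is the uniform distribution on the non-empty affine subspace `A`: it has the value
`2 ^ (-dim A)` on `A` and `0` elsewhere. -/
def IsUniformOn {n : ℕ} (P : PMF (Bits n)) (A : AffineSubspace (ZMod 2) (Bits n)) : Prop :=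
  (A : Set (Bits n)).Nonempty ∧
  (∀ x ∈ A, (P x).toReal = ((2 : ℝ) ^ Module.finrank (ZMod 2) A.direction)⁻¹) ∧
  (∀ x ∉ A, (P x).toReal = 0)

/-! ## Clifford gates and one-dimensional nearest-neighbour circuits -/

/-- Operators on `n` qubits, in the computational basis. -/
abbrev QOp (n : ℕ) : Type := Matrix (Bits n) (Bits n) ℂ

/-- The Pauli operator `X ^ a * Z ^ b`, which maps `|y⟩` to `(-1) ^ (b ⬝ y) |y + a⟩`. -/
def pauliOp {n : ℕ} (a b : Bits n) : QOp n :=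
  fun x y => if x = y + a then (-1 : ℂ) ^ (b ⬝ᵥ y).val else 0

/-- The Pauli group on `n` qubits: the operators `i ^ k * X ^ a * Z ^ b`. -/
def pauliGroup (n : ℕ) : Set (QOp n) :=
  {M | ∃ (k : ℕ) (a b : Bits n), M = Complex.I ^ k • pauliOp a b}

/-- The Clifford operators on `n` qubits: the unitaries that map the Pauli group to itself by
conjugation. -/
def cliffordOps (n : ℕ) : Set (QOp n) :=
  {U | U ∈ Matrix.unitaryGroup (Bits n) ℂ ∧
    ∀ M ∈ pauliGroup n, U * M * U.conjTranspose ∈ pauliGroup n}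

/-- A gate from the gate set `𝒢` (`𝒢 k` holds the `k`-qubit gates), placed on one qubit or on two
neighbouring qubits, namely on the qubits `start, …, start + width - 1`, of a line of `n` qubits. -/
structure PlacedGate (𝒢 : (k : ℕ) → Set (QOp k)) (n : ℕ) where
  start : ℕ
  width : ℕ
  width_pos : 1 ≤ width
  width_le : width ≤ 2
  fits : start + width ≤ n
  op : QOp width
  op_mem : op ∈ 𝒢 width

namespace PlacedGate

variable {𝒢 : (k : ℕ) → Set (QOp k)} {n : ℕ}

/-- The qubit of the line to which the `i`-th qubit of the gate is attached. -/
def wire (g : PlacedGate 𝒢 n) (i : Fin g.width) : Fin n :=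
  ⟨g.start + i, by have := g.fits; have := i.isLt; omega⟩

/-- The qubits on which the gate acts. -/
def support (g : PlacedGate 𝒢 n) : Set (Fin n) := Set.range g.wire

open Classical in
/-- The operator of a placed gate on all `n` qubits: the gate on its own qubits, tensored with the
identity on the others. -/
noncomputable def toOp (g : PlacedGate 𝒢 n) : QOp n :=
  fun x y => if ∀ q ∉ g.support, x q = y q
    then g.op (fun i => x (g.wire i)) (fun i => y (g.wire i)) else 0

end PlacedGate

/-- A layer of a circuit: gates that act in parallel, on disjoint sets of qubits. -/
structure GateLayer (𝒢 : (k : ℕ) → Set (QOp k)) (n : ℕ) where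
  gates : List (PlacedGate 𝒢 n)
  disjoint : gates.Pairwise (fun g h => Disjoint g.support h.support)

/-- The operator of a layer (its gates commute). -/
noncomputable def GateLayer.toOp {𝒢 : (k : ℕ) → Set (QOp k)} {n : ℕ} (L : GateLayer 𝒢 n) :
    QOp n :=
  (L.gates.map PlacedGate.toOp).prod

/-- The operator of a circuit, given as the list of its layers; the last layer of the list is the
first one to be applied. -/
noncomputable def circuitOp {𝒢 : (k : ℕ) → Set (QOp k)} {n : ℕ} (L : List (GateLayer 𝒢 n)) :
    QOp n :=
  (L.map GateLayer.toOp).prod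

/-- The output distributions `P x = |⟨x|U|0⟩|²` of the `n`-qubit nearest-neighbour circuits of
depth `d` with gates from `𝒢`. -/
def circuitDist (𝒢 : (k : ℕ) → Set (QOp k)) (n d : ℕ) : Set (PMF (Bits n)) :=
  {P | ∃ L : List (GateLayer 𝒢 n), L.length = d ∧
    ∀ x, (P x).toReal = ‖circuitOp L x 0‖ ^ 2}

/-- The output distributions of `n`-qubit Clifford circuits of depth `d`. -/
def cliffordDist (n d : ℕ) : Set (PMF (Bits n)) := circuitDist cliffordOps n d

/-! ## The machine model

A random access machine with unit cost whose arithmetic is addition and truncated subtraction,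
with coin flips and a sample oracle. It has registers and a memory that is addressed through
registers, both of which hold natural numbers. Programs are structured; every elementary
instruction, every test and every unfolding of a sequence is one computation step. Without
multiplication, numbers grow by at most one bit in a step, so that polynomial time is the usual
notion. -/

/-- Elementary instructions. -/
inductive Instr : Type
  /-- `reg i := k` -/
  | const (i k : ℕ)
  /-- `reg i := reg j + reg k` -/
  | add (i j k : ℕ)
  /-- `reg i := reg j - reg k`, truncated at `0` -/
  | sub (i j k : ℕ)
  /-- `reg i := mem (reg j)` -/
  | load (i j : ℕ)
  /-- `mem (reg i) := reg j` -/
  | store (i j : ℕ)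
  /-- `reg i :=` a fresh fair coin flip -/
  | flip (i : ℕ)
  /-- ask the oracle for a fresh sample and put it into the sample buffer -/
  | query
  /-- `reg i :=` bit number `reg j` of the sample in the buffer -/
  | read (i j : ℕ)

/-- Programs. -/
inductive Prog : Type
  | skip
  | instr (a : Instr)
  /-- first `p`, then `q` -/
  | seq (p q : Prog)
  /-- if `reg i ≠ 0` then `p` else `q` -/
  | ite (i : ℕ) (p q : Prog)
  /-- while `reg i ≠ 0` do `p` -/
  | loop (i : ℕ) (p : Prog)

/-- The code of an instruction, an opcode followed by the operands. -/
def Instr.code : Instr → List ℕ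
  | .const i k => [1, i, k]
  | .add i j k => [2, i, j, k]
  | .sub i j k => [3, i, j, k]
  | .load i j => [4, i, j]
  | .store i j => [5, i, j]
  | .flip i => [6, i]
  | .query => [7]
  | .read i j => [8, i, j]

/-- The code of a program, in prefix notation. Every opcode has a fixed number of arguments, so
that the code is self-delimiting. -/
def Prog.code : Prog → List ℕ
  | .skip => [9]
  | .instr a => a.code
  | .seq p q => 10 :: (p.code ++ q.code)
  | .ite i p q => 11 :: i :: (p.code ++ q.code)
  | .loop i p => 12 :: i :: p.code

/-- The data of the machine. -/
structure MState where
  reg : ℕ → ℕ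
  mem : ℕ → ℕ
  /-- the bits of the sample in the buffer -/
  buf : ℕ → ℕ
  /-- the number of samples requested so far -/
  queries : ℕ
  /-- the number of coins flipped so far -/
  flips : ℕ

/-- The state with the given registers and memory, before any sample or coin. -/
def MState.start (reg mem : ℕ → ℕ) : MState := ⟨reg, mem, fun _ => 0, 0, 0⟩

/-- Register contents with the numbers of a list in the first registers and `0` in all others. -/
def regsOf (l : List ℕ) : ℕ → ℕ := fun i => l.getD i 0

/-- A bit string as a sequence of numbers `0` and `1`, continued by zeros. -/
def bitSeq {n : ℕ} (x : Bits n) : ℕ → ℕ := fun i => if h : i < n then (x ⟨i, h⟩).val else 0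

/-- The effect of an instruction, where `X` is the sequence of the answers of the sample oracle and
`C` the sequence of the outcomes of the coin flips. -/
def Instr.exec {n : ℕ} (X : ℕ → Bits n) (C : ℕ → Bool) (s : MState) : Instr → MState
  | .const i k => { s with reg := Function.update s.reg i k }
  | .add i j k => { s with reg := Function.update s.reg i (s.reg j + s.reg k) }
  | .sub i j k => { s with reg := Function.update s.reg i (s.reg j - s.reg k) }
  | .load i j => { s with reg := Function.update s.reg i (s.mem (s.reg j)) }
  | .store i j => { s with mem := Function.update s.mem (s.reg i) (s.reg j) }
  | .flip i => { s with
      reg := Function.update s.reg i (C s.flips).toNat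
      flips := s.flips + 1 }
  | .query => { s with
      buf := bitSeq (X s.queries)
      queries := s.queries + 1 }
  | .read i j => { s with reg := Function.update s.reg i (s.buf (s.reg j)) }

/-- A configuration: the stack of the programs that are still to be executed, and the data. The
machine has halted when the stack is empty. -/
abbrev MConfig : Type := List Prog × MState

/-- One computation step. -/
def stepM {n : ℕ} (X : ℕ → Bits n) (C : ℕ → Bool) : MConfig → MConfig
  | ([], s) => ([], s)
  | (.skip :: K, s) => (K, s)
  | (.instr a :: K, s) => (K, a.exec X C s)
  | (.seq p q :: K, s) => (p :: q :: K, s)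
  | (.ite i p q :: K, s) => (if s.reg i ≠ 0 then p :: K else q :: K, s)
  | (.loop i p :: K, s) => (if s.reg i ≠ 0 then p :: .loop i p :: K else K, s)

/-- With the samples `X` and the coins `C`, the program `p` started in the state `s` halts within
`T` steps, in the state `s'`. -/
def RunsTo {n : ℕ} (X : ℕ → Bits n) (C : ℕ → Bool) (p : Prog) (s : MState) (T : ℕ)
    (s' : MState) : Prop :=
  (stepM X C)^[T] ([p], s) = ([], s')

/-- The sample oracle of a program that has no access to samples. -/
def noSamples : ℕ → Bits 0 := fun _ => 0

/-- The law of a sequence of independent fair coin flips. -/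
noncomputable def coinMeasure : Measure (ℕ → Bool) :=
  Measure.infinitePi fun _ : ℕ => (PMF.uniformOfFintype Bool).toMeasure

/-- The law of a sequence of independent samples from `P`. -/
noncomputable def sampleMeasure {n : ℕ} (P : PMF (Bits n)) : Measure (ℕ → Bits n) :=
  Measure.infinitePi fun _ : ℕ => P.toMeasure

/-- The law of the sample sequence and the coin flips of a program with access to samples
from `P`. -/
noncomputable def learnerMeasure {n : ℕ} (P : PMF (Bits n)) :
    Measure ((ℕ → Bits n) × (ℕ → Bool)) :=
  (sampleMeasure P).prod coinMeasure

/-! ## Generators, evaluators and learning -/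

/-- `G` is a generator for `Q` with running time at most `T`: started with empty registers and
memory, it always halts within `T` steps, and the bit string that it leaves in memory, from the
address in register `0` on, has the distribution `Q`. -/
def IsGenerator (n T : ℕ) (G : Prog) (Q : PMF (Bits n)) : Prop :=
  (∀ C, ∃ s', RunsTo noSamples C G (.start (regsOf []) 0) T s') ∧
  ∀ x : Bits n, coinMeasure {C | ∃ s', RunsTo noSamples C G (.start (regsOf []) 0) T s' ∧
    ∀ i : Fin n, s'.mem (s'.reg 0 + i) = (x i).val} = Q x

/-- `E` is an evaluator for `Q` with running time at most `T`: started with any bit string `x` in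
memory, it halts within `T` steps, whatever coins it may flip, with numerator and denominator
of `Q x` in the registers `0` and `1`. -/
def IsEvaluator (n T : ℕ) (E : Prog) (Q : PMF (Bits n)) : Prop :=
  ∀ (x : Bits n) (C : ℕ → Bool), ∃ s',
    RunsTo noSamples C E (.start (regsOf []) (bitSeq x)) T s' ∧
    s'.reg 1 ≠ 0 ∧ (Q x).toReal = (s'.reg 0 : ℝ) / (s'.reg 1 : ℝ)

/-- The final state `s` holds in memory, from the address in register `0` on, the code of the
program `p`. -/
def MState.ReturnsCode (s : MState) (p : Prog) : Prop :=
  ∀ i : Fin p.code.length, s.mem (s.reg 0 + i) = p.code.get i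

/-- The family `𝒟` of distribution classes is efficiently learnable from samples with respect to
the kind of representation `IsRep` (generators or evaluators, `IsRep n T R Q` means that the
program `R` represents `Q` and runs in time `T`). There is one program, the learner, which is
given `n`, `⌈1/ε⌉`, `⌈1/δ⌉` in its first three registers and access to samples from any unknown
`P` in the class. It always halts in time polynomial in `n`, `1/ε`, `1/δ`, and with probability at
least `1 - δ` it returns the code of a program which represents, in time polynomial in `n`, a
distribution `Q` at distance less than `ε` from `P`. -/
def EfficientlyLearnable (IsRep : (n T : ℕ) → Prog → PMF (Bits n) → Prop)
    (𝒟 : (n : ℕ) → Set (PMF (Bits n))) : Prop :=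
  ∃ (A : Prog) (c : ℕ), ∀ (n : ℕ) (ε δ : ℝ), 0 < ε → ε < 1 → 0 < δ → δ < 1 →
    let s₀ : MState := .start (regsOf [n, ⌈1 / ε⌉₊, ⌈1 / δ⌉₊]) 0
    let T : ℕ := ⌊(c : ℝ) * (n + 1 / ε + 1 / δ) ^ c⌋₊
    (∀ (X : ℕ → Bits n) (C : ℕ → Bool), ∃ s', RunsTo X C A s₀ T s') ∧
    ∀ P ∈ 𝒟 n, 1 - δ ≤ (learnerMeasure P).real
      {ω | ∃ s' R Q, RunsTo ω.1 ω.2 A s₀ T s' ∧ s'.ReturnsCode R ∧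
        IsRep n (c * (n + 1) ^ c) R Q ∧ tvDist P Q < ε}

/-! ## Recovery of an affine subspace by Gaussian elimination -/

/-- The final state `s` holds the pair `(R, t)`: register `0` holds the number `m` of columns, and
from the address in register `1` on the memory holds `t` and then the columns of `R`. -/
def MState.ReturnsParam (s : MState) {n m : ℕ} (R : Matrix (Fin n) (Fin m) (ZMod 2))
    (t : Bits n) : Prop :=
  s.reg 0 = m ∧ (∀ i : Fin n, s.mem (s.reg 1 + i) = (t i).val) ∧
  ∀ (i : Fin n) (j : Fin m), s.mem (s.reg 1 + (j + 1) * n + i) = (R i j).val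

/-- The columns of `R` form a maximal linearly independent subfamily of the family `y`. -/
def IsMaxIndepSubfamily {n m k : ℕ} (y : Fin k → Bits n)
    (R : Matrix (Fin n) (Fin m) (ZMod 2)) : Prop :=
  LinearIndependent (ZMod 2) (fun j i => R i j) ∧
  (∀ j : Fin m, ∃ l : Fin k, (fun i => R i j) = y l) ∧
  ∀ l : Fin k, y l ∈ Submodule.span (ZMod 2) (Set.range fun (j : Fin m) i => R i j)

/-- `(R, t)` parametrizes `A`: the matrix `R` has full column rank and `A = {R b + t}`. -/
def Parametrizes {n m : ℕ} (R : Matrix (Fin n) (Fin m) (ZMod 2)) (t : Bits n)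
    (A : AffineSubspace (ZMod 2) (Bits n)) : Prop :=
  LinearIndependent (ZMod 2) (fun j i => R i j) ∧
  (A : Set (Bits n)) = {x | ∃ b : Bits m, x = R.mulVec b + t}

/-- The program `G` recovers affine subspaces from uniform samples `x₀, x₁, …` by Gaussian
elimination, in time polynomial in `n` and `1/δ`. Given `n` and `⌈1/δ⌉`, it takes exactly
`k = n + 1 + ⌈log₂ (1/δ)⌉` samples and returns `(R, x₀)`, where the columns of `R` are a maximal
linearly independent subfamily of `x₀ + x₀, …, xₖ₋₁ + x₀`; if the samples are uniform on an affine
subspace, then with probability at least `1 - δ` the output parametrizes it. -/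
def RecoversAffineSubspaces (G : Prog) : Prop :=
  ∃ c : ℕ, ∀ (n : ℕ) (δ : ℝ), 0 < δ → δ < 1 →
    let k : ℕ := n + 1 + ⌈Real.logb 2 (1 / δ)⌉₊
    let s₀ : MState := .start (regsOf [n, ⌈1 / δ⌉₊]) 0
    let T : ℕ := ⌊(c : ℝ) * (n + 1 / δ) ^ c⌋₊
    (∀ (X : ℕ → Bits n) (C : ℕ → Bool),
      ∃ (s' : MState) (m : ℕ) (R : Matrix (Fin n) (Fin m) (ZMod 2)),
        RunsTo X C G s₀ T s' ∧ s'.queries = k ∧ s'.ReturnsParam R (X 0) ∧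
        IsMaxIndepSubfamily (fun l : Fin k => X l + X 0) R) ∧
    ∀ (A : AffineSubspace (ZMod 2) (Bits n)) (P : PMF (Bits n)), IsUniformOn P A →
      1 - δ ≤ (learnerMeasure P).real
        {ω | ∃ (s' : MState) (m : ℕ) (R : Matrix (Fin n) (Fin m) (ZMod 2)) (t : Bits n),
          RunsTo ω.1 ω.2 G s₀ T s' ∧ s'.ReturnsParam R t ∧ Parametrizes R t A}

/-! Conjugation by the circuit unitary `U` turns the operators `Z ^ b` into Pauli operators `M b`,
whose average over `b` is the projector onto `U|0⟩`. Hence `2 ^ n * P x` is the sum of the entries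
`M b x x`. Only the `M b` without `X`-part contribute, each a phase times a character of `x`. The
points where all these entries are `1` form an affine subspace `A`. On `A` the sum counts the
contributing `b`; elsewhere a translation in `b` multiplies the sum by a factor other than `1`, so
it vanishes. This is `exists_isUniformOn_of_clifford`; `PlacedGate.toOp_mem_cliffordOps` makes it
applicable to circuits.

Learning thus means finding `A`. One sample serves as base point, and the differences to it generate
the direction of `A` unless some functional that is not constant on `A` is constant on the samples.
Such a functional takes a given value on a uniform point of `A` with probability `1/2`, so a union
bound over at most `2 ^ (n + 1)` pairs of a functional and a value leaves failure probability at
most `2 ^ (-N)` after `n + 1 + N` samples (`le_measure_of_spans`). On success `P` is recovered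
exactly, so `ε` plays no role.

The computation is incremental Gaussian elimination: `Reduction` follows one vector through the
rows, `GaussState` is the invariant over the samples. Two families with the same span are kept: the
unreduced independent differences, which are the required columns, and an echelon family, which
decides independence and membership. The learner then writes a straight-line program that stores the
echelon family and the base point, followed by a fixed tail. The generator adds a random combination
of rows to the base point (`coinMeasure_coinSum`); the evaluator reduces `x + t` and returns `0` or
`1` over `2 ^ m`. Programs are verified with `wp`, whose time budgets add up under composition. -/

/-! ## Weakest preconditions with running times -/

/-- Started in `s`, the program `p` halts within `t` steps in a state that satisfies `Q`, whatever
is on the stack below it. -/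
def wp {n : ℕ} (X : ℕ → Bits n) (C : ℕ → Bool) (p : Prog) (t : ℕ) (Q : MState → Prop)
    (s : MState) : Prop :=
  ∃ s', (∃ t' ≤ t, ∀ K, (stepM X C)^[t'] (p :: K, s) = (K, s')) ∧ Q s'

/-- A sequence of instructions, as a program. -/
def block : List Instr → Prog
  | [] => .skip
  | a :: l => .seq (.instr a) (block l)

section wp

variable {n : ℕ} {X : ℕ → Bits n} {C : ℕ → Bool} {p q : Prog} {t t₁ t₂ : ℕ}
  {Q Q₁ : MState → Prop} {s : MState}

theorem wp.mono (h : wp X C p t₁ Q₁ s) (ht : t₁ ≤ t) (hQ : ∀ s', Q₁ s' → Q s') :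
    wp X C p t Q s := by
  obtain ⟨s', ⟨t', ht', h⟩, hs⟩ := h
  exact ⟨s', ⟨t', ht'.trans ht, h⟩, hQ _ hs⟩

theorem wp.le (h : wp X C p t₁ Q s) (ht : t₁ ≤ t) : wp X C p t Q s := h.mono ht fun _ => id

theorem wp_skip (h : Q s) : wp X C .skip 1 Q s := ⟨s, ⟨1, le_rfl, fun _ => rfl⟩, h⟩

theorem wp_instr {a : Instr} (h : Q (a.exec X C s)) : wp X C (.instr a) 1 Q s :=
  ⟨_, ⟨1, le_rfl, fun _ => rfl⟩, h⟩

theorem wp_seq (h : wp X C p t₁ (fun s' => wp X C q t₂ Q s') s) :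
    wp X C (.seq p q) (t₁ + t₂ + 1) Q s := by
  obtain ⟨s₁, ⟨a, ha, h₁⟩, s₂, ⟨b, hb, h₂⟩, hQ⟩ := h
  refine ⟨s₂, ⟨b + (a + 1), by omega, fun K => ?_⟩, hQ⟩
  rw [Function.iterate_add_apply, Function.iterate_succ_apply]
  change (stepM X C)^[b] ((stepM X C)^[a] (p :: q :: K, s)) = _
  rw [h₁, h₂]

theorem wp_ite {i : ℕ} (h₁ : s.reg i ≠ 0 → wp X C p t Q s) (h₂ : s.reg i = 0 → wp X C q t Q s) :
    wp X C (.ite i p q) (t + 1) Q s := by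
  by_cases h : s.reg i = 0
  · obtain ⟨s', ⟨a, ha, h'⟩, hQ⟩ := h₂ h
    refine ⟨s', ⟨a + 1, by omega, fun K => ?_⟩, hQ⟩
    rw [Function.iterate_succ_apply]
    simp [stepM, h, h']
  · obtain ⟨s', ⟨a, ha, h'⟩, hQ⟩ := h₁ h
    refine ⟨s', ⟨a + 1, by omega, fun K => ?_⟩, hQ⟩
    rw [Function.iterate_succ_apply]
    simp [stepM, h, h']

/-- A loop that is run `N` times, with the invariant `I`. -/
theorem wp_loop {i : ℕ} (I : ℕ → MState → Prop) (N : ℕ)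
    (hstep : ∀ j s, j < N → I j s → s.reg i ≠ 0 ∧ wp X C p t (I (j + 1)) s)
    (hend : ∀ s, I N s → s.reg i = 0) (h₀ : I 0 s) :
    wp X C (.loop i p) (N * (t + 1) + 1) (I N) s := by
  -- Induction on the number `k` of iterations that remain.
  suffices H : ∀ k s, k ≤ N → I (N - k) s → wp X C (.loop i p) (k * (t + 1) + 1) (I N) s from
    H N s le_rfl (by simpa using h₀)
  intro k
  induction k with
  | zero =>
    intro s _ hs
    refine ⟨s, ⟨1, by omega, fun K => ?_⟩, hs⟩
    simp [stepM, hend s hs]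
  | succ k ih =>
    intro s hk hs
    obtain ⟨h0, s₁, ⟨a, ha, h₁⟩, hI⟩ := hstep _ s (by omega) hs
    rw [show N - (k + 1) + 1 = N - k by omega] at hI
    obtain ⟨s₂, ⟨b, hb, h₂⟩, hN⟩ := ih s₁ (by omega) hI
    refine ⟨s₂, ⟨b + (a + 1), by rw [add_mul]; omega, fun K => ?_⟩, hN⟩
    rw [Function.iterate_add_apply, Function.iterate_succ_apply]
    have : stepM X C (.loop i p :: K, s) = (p :: .loop i p :: K, s) := by simp [stepM, h0]
    rw [this, h₁, h₂]

theorem wp_block {l : List Instr} (h : Q (l.foldl (fun s a => a.exec X C s) s)) :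
    wp X C (block l) (2 * l.length + 1) Q s := by
  induction l generalizing s with
  | nil => exact wp_skip h
  | cons a l ih =>
    refine (wp_seq (t₁ := 1) (t₂ := 2 * l.length + 1) (wp_instr (ih h))).le ?_
    simp; omega

/-- Instructions followed by a program. -/
def Prog.after (l : List Instr) (p : Prog) : Prog := l.foldr (fun a q => .seq (.instr a) q) p

theorem wp_after {l : List Instr} (h : wp X C p t Q (l.foldl (fun s a => a.exec X C s) s)) :
    wp X C (.after l p) (t + 2 * l.length) Q s := by
  induction l generalizing s with
  | nil => exact h
  | cons a l ih =>
    refine (wp_seq (t₁ := 1) (t₂ := t + 2 * l.length) (wp_instr (ih h))).le ?_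
    simp; omega

theorem stepM_iterate_halted (T : ℕ) : (stepM X C)^[T] ([], s) = ([], s) :=
  Function.iterate_fixed rfl T

/-- An empty stack is a fixed point of `stepM`, so a run that halts early is still halted when the
budget is used up. -/
theorem wp.runsTo (h : wp X C p t Q s) : ∃ s', RunsTo X C p s t s' ∧ Q s' := by
  obtain ⟨s', ⟨t', ht', h⟩, hQ⟩ := h
  refine ⟨s', ?_, hQ⟩
  obtain ⟨d, rfl⟩ := Nat.exists_eq_add_of_le' ht'
  rw [RunsTo, Function.iterate_add_apply, h, stepM_iterate_halted]

theorem RunsTo.unique {s₁ s₂ : MState} (h₁ : RunsTo X C p s t s₁) (h₂ : RunsTo X C p s t s₂) :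
    s₁ = s₂ := by
  unfold RunsTo at h₁ h₂
  exact (Prod.mk.inj (h₁.symm.trans h₂)).2

end wp

/-- Registers below `r`, the sample buffer, the numbers of samples and of coins are the same. -/
structure MState.Agree (r : ℕ) (s s' : MState) : Prop where
  reg : ∀ i < r, s'.reg i = s.reg i
  buf : s'.buf = s.buf
  queries : s'.queries = s.queries
  flips : s'.flips = s.flips

theorem MState.Agree.refl (r : ℕ) (s : MState) : s.Agree r s := ⟨fun _ _ => rfl, rfl, rfl, rfl⟩

theorem MState.Agree.trans {r : ℕ} {s₁ s₂ s₃ : MState} (h : s₁.Agree r s₂) (h' : s₂.Agree r s₃) :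
    s₁.Agree r s₃ :=
  ⟨fun i hi => (h'.reg i hi).trans (h.reg i hi), h'.buf.trans h.buf,
    h'.queries.trans h.queries, h'.flips.trans h.flips⟩

theorem MState.Agree.mono {r r' : ℕ} {s₁ s₂ : MState} (h : s₁.Agree r s₂) (hr : r' ≤ r) :
    s₁.Agree r' s₂ :=
  ⟨fun i hi => h.reg i (hi.trans_le hr), h.buf, h.queries, h.flips⟩

/-! ## Vector operations -/

/-- The memory `mem` after writing `val 0, …, val (n - 1)` from the address `d` on. -/
def writeVec (d n : ℕ) (val mem : ℕ → ℕ) : ℕ → ℕ :=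
  fun a => if d ≤ a ∧ a < d + n then val (a - d) else mem a

/-- Register `2` holds the number of bits, `3` holds one and `9` holds zero. -/
structure MState.Std (n : ℕ) (s : MState) : Prop where
  reg2 : s.reg 2 = n
  reg3 : s.reg 3 = 1
  reg9 : s.reg 9 = 0

theorem MState.Std.of_agree {n r : ℕ} {s s' : MState} (h : s.Std n) (h' : s.Agree r s')
    (hr : 10 ≤ r := by norm_num) : s'.Std n :=
  ⟨(h'.reg _ (by omega)).trans h.reg2, (h'.reg _ (by omega)).trans h.reg3,
    (h'.reg _ (by omega)).trans h.reg9⟩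

/-- Run the instructions for every index, which is held in register `21`. -/
def vecLoop (body : List Instr) : Prog :=
  .after [.add 20 2 9, .const 21 0]
    (.loop 20 (.seq (block body) (block [.add 21 21 3, .sub 20 20 3])))

section

variable {n₀ n : ℕ} {X : ℕ → Bits n₀} {C : ℕ → Bool} {s₀ : MState}

/-- The body at index `i` sees the memory already overwritten at the earlier indices; overlap of
source and target is left to the callers. Registers `20` and `21` hold the counter and the index,
those from `22` on are free for the body. -/
theorem wp_vecLoop {body : List Instr} {d : ℕ} {val : ℕ → ℕ} (hs : s₀.Std n)
    (hbody : ∀ i < n, ∀ s, s₀.Agree 20 s → s.reg 21 = i → s.mem = writeVec d i val s₀.mem →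
      s.Agree 22 (body.foldl (fun s a => a.exec X C s) s) ∧
      (body.foldl (fun s a => a.exec X C s) s).mem = Function.update s.mem (d + i) (val i)) :
    wp X C (vecLoop body) ((2 * body.length + 8) * n + 5)
      (fun s => s₀.Agree 20 s ∧ s.mem = writeVec d n val s₀.mem) s₀ := by
  have key : wp X C (vecLoop body) (n * ((2 * body.length + 1) + 5 + 1 + 1) + 1 + 2 * 2)
      (fun s => s₀.Agree 20 s ∧ s.mem = writeVec d n val s₀.mem) s₀ := by
    refine wp_after ?_
    refine (wp_loop (fun j s => s₀.Agree 20 s ∧ s.reg 20 = n - j ∧ s.reg 21 = j ∧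
      s.mem = writeVec d j val s₀.mem) n ?_ ?_ ?_).mono le_rfl fun s h => ⟨h.1, h.2.2.2⟩
    · rintro j s hj ⟨hA, h20, h21, hm⟩
      refine ⟨by omega, ?_⟩
      refine wp_seq (t₁ := 2 * body.length + 1) (t₂ := 5) (wp_block (wp_block ?_))
      obtain ⟨hA', hm'⟩ := hbody j hj s hA h21 hm
      set s' := body.foldl (fun s a => a.exec X C s) s
      have h3 : s'.reg 3 = 1 := ((hs.of_agree hA).of_agree hA').reg3
      have h20' : s'.reg 20 = n - j := (hA'.reg _ (by norm_num)).trans h20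
      have h21' : s'.reg 21 = j := (hA'.reg _ (by norm_num)).trans h21
      have hB := hA.trans (hA'.mono (r' := 20) (by norm_num))
      refine ⟨⟨fun i hi => ?_, ?_, ?_, ?_⟩, ?_, ?_, ?_⟩
      · have : i ≠ 20 := by omega
        have : i ≠ 21 := by omega
        simp [Instr.exec, *]
        exact hB.reg i hi
      · exact hB.buf
      · exact hB.queries
      · exact hB.flips
      · simp [Instr.exec, *]; omega
      · simp [Instr.exec, *]
      · simp only [List.foldl, Instr.exec, hm', hm]
        funext a
        simp only [Function.update_apply, writeVec]
        by_cases ha : a = d + j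
        · subst ha; simp
        · rw [if_neg ha]
          have : (d ≤ a ∧ a < d + j) ↔ (d ≤ a ∧ a < d + (j + 1)) := by omega
          simp only [this]
    · rintro s ⟨-, h, -⟩
      simpa using h
    · refine ⟨⟨fun i hi => ?_, rfl, rfl, rfl⟩, ?_, ?_, ?_⟩
      · have : i ≠ 20 := by omega
        have : i ≠ 21 := by omega
        simp [Instr.exec, *]
      · simp [Instr.exec, hs.reg2, hs.reg9]
      · simp [Instr.exec]
      · funext a
        simp [Instr.exec, writeVec]
  refine key.le ?_
  have : n * ((2 * body.length + 1) + 5 + 1 + 1) = (2 * body.length + 8) * n := by ring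
  omega

/-- Add the vector at the address in register `14` to the vector at `0`. -/
def vecXor : Prog :=
  vecLoop [.add 22 14 21, .load 22 22, .load 23 21, .sub 24 22 23, .sub 25 23 22, .add 22 24 25,
    .store 21 22]

/-- Copy the vector at `0` to the address in register `14`. -/
def vecCopy : Prog := vecLoop [.load 22 21, .add 23 14 21, .store 23 22]

/-- Write the current sample to the address in register `14`. -/
def vecRead : Prog := vecLoop [.read 22 21, .add 23 14 21, .store 23 22]

/-- Truncated subtraction in both orders gives the absolute difference, which on bits is addition
modulo two. -/
theorem wp_vecXor (hs : s₀.Std n) :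
    wp X C vecXor (22 * n + 5) (fun s => s₀.Agree 20 s ∧ s.mem = writeVec 0 n
      (fun i => (s₀.mem (s₀.reg 14 + i) - s₀.mem i) + (s₀.mem i - s₀.mem (s₀.reg 14 + i)))
      s₀.mem) s₀ := by
  refine wp_vecLoop hs fun i hi s hA h21 hm => ⟨⟨fun j hj => ?_, rfl, rfl, rfl⟩, ?_⟩
  · have : j ≠ 22 ∧ j ≠ 23 ∧ j ≠ 24 ∧ j ≠ 25 := by omega
    simp [Instr.exec, *]
  · have h14 : s.reg 14 = s₀.reg 14 := hA.reg _ (by norm_num)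
    have h1 : writeVec 0 i (fun i => (s₀.mem (s₀.reg 14 + i) - s₀.mem i) +
        (s₀.mem i - s₀.mem (s₀.reg 14 + i))) s₀.mem i = s₀.mem i := by simp [writeVec]
    -- Only addresses below `i` have been overwritten, so this entry is intact wherever the second
    -- vector lies.
    have h2 : writeVec 0 i (fun i => (s₀.mem (s₀.reg 14 + i) - s₀.mem i) +
        (s₀.mem i - s₀.mem (s₀.reg 14 + i))) s₀.mem (s₀.reg 14 + i) = s₀.mem (s₀.reg 14 + i) := by
      rw [writeVec, if_neg (by omega)]
    simp [Instr.exec, *]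

theorem wp_vecCopy (hs : s₀.Std n) (hsrc : n ≤ s₀.reg 14) :
    wp X C vecCopy (14 * n + 5) (fun s => s₀.Agree 20 s ∧
      s.mem = writeVec (s₀.reg 14) n s₀.mem s₀.mem) s₀ := by
  refine wp_vecLoop hs fun i hi s hA h21 hm => ⟨⟨fun j hj => ?_, rfl, rfl, rfl⟩, ?_⟩
  · have : j ≠ 22 ∧ j ≠ 23 := by omega
    simp [Instr.exec, *]
  · have h14 : s.reg 14 = s₀.reg 14 := hA.reg _ (by norm_num)
    have h1 : writeVec (s₀.reg 14) i s₀.mem s₀.mem i = s₀.mem i := by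
      rw [writeVec, if_neg (by omega)]
    simp [Instr.exec, *]

theorem wp_vecRead (hs : s₀.Std n) :
    wp X C vecRead (14 * n + 5) (fun s => s₀.Agree 20 s ∧
      s.mem = writeVec (s₀.reg 14) n s₀.buf s₀.mem) s₀ := by
  refine wp_vecLoop hs fun i hi s hA h21 hm => ⟨⟨fun j hj => ?_, rfl, rfl, rfl⟩, ?_⟩
  · have : j ≠ 22 ∧ j ≠ 23 := by omega
    simp [Instr.exec, *]
  · have h14 : s.reg 14 = s₀.reg 14 := hA.reg _ (by norm_num)
    have hb : s.buf = s₀.buf := hA.buf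
    simp [Instr.exec, *]

end

/-! ## Bases in echelon form -/

/-- The row `p` of `B` is zero or has its first non-zero entry at `p`. -/
def IsEchelon {n : ℕ} (B : Fin n → Bits n) : Prop :=
  ∀ p, (∀ q < p, B p q = 0) ∧ (B p p = 0 → B p = 0)

theorem isEchelon_zero {n : ℕ} : IsEchelon (0 : Fin n → Bits n) :=
  fun _ => ⟨fun _ _ => rfl, fun _ => rfl⟩

theorem zmod_two_ne_zero {a : ZMod 2} (h : a ≠ 0) : a = 1 := by
  revert a; decide

theorem bits_add_self {n : ℕ} (x : Bits n) : x + x = 0 :=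
  funext fun i => CharTwo.add_self_eq_zero (x i)

theorem bits_sub {n : ℕ} (x y : Bits n) : x - y = x + y :=
  funext fun i => CharTwo.sub_eq_add (x i) (y i)

/-- The system is triangular: the leading coordinates kill the terms before `p` one after the other,
and later rows do not reach coordinate `p`. So a vector whose first non-zero entry belongs to an
empty row is not in the span. -/
theorem IsEchelon.apply_eq_zero {n : ℕ} {B : Fin n → Bits n} (hB : IsEchelon B) {w : Bits n}
    (hw : w ∈ Submodule.span (ZMod 2) (Set.range B)) {p : Fin n} (h : ∀ q < p, w q = 0)
    (hp : B p = 0) : w p = 0 := by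
  obtain ⟨c, rfl⟩ := (Submodule.mem_span_range_iff_exists_fun _).1 hw
  have key : ∀ q, q ≤ p → (∀ r < q, c r • B r = 0) → (∑ r, c r • B r) q = c q * B q q := by
    intro q hq hr
    rw [Finset.sum_apply, Finset.sum_eq_single q]
    · rfl
    · intro r _ hrq
      rcases lt_or_gt_of_ne hrq with h' | h'
      · rw [hr r h']; rfl
      · simp [(hB r).1 q h']
    · simp
  have hz : ∀ q, q < p → c q • B q = 0 := by
    intro q
    induction q using WellFoundedLT.induction with
    | ind q ih =>
      intro hq
      have h1 := key q hq.le fun r hr => ih r hr (hr.trans hq)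
      rw [h q hq] at h1
      -- Either the coefficient vanishes, or the pivot does and then the whole row.
      rcases mul_eq_zero.1 h1.symm with h2 | h2
      · rw [h2, zero_smul]
      · rw [(hB q).2 h2, smul_zero]
  rw [key p le_rfl hz, hp]
  simp

theorem IsEchelon.update {n : ℕ} {B : Fin n → Bits n} (hB : IsEchelon B) {v : Bits n} {p : Fin n}
    (hv : ∀ q < p, v q = 0) (hp : v p ≠ 0) : IsEchelon (Function.update B p v) := by
  intro r
  by_cases hr : r = p
  · subst hr
    rw [Function.update_self]
    exact ⟨hv, fun h => absurd h hp⟩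
  · rw [Function.update_of_ne hr]
    exact hB r

/-- Replacing a zero row by `v` adds `v` to the span. -/
theorem span_range_update {n : ℕ} {B : Fin n → Bits n} {v : Bits n} {p : Fin n} (hp : B p = 0) :
    Submodule.span (ZMod 2) (Set.range (Function.update B p v)) =
      Submodule.span (ZMod 2) (Set.range B) ⊔ Submodule.span (ZMod 2) {v} := by
  apply le_antisymm
  · rw [Submodule.span_le]
    rintro _ ⟨r, rfl⟩
    by_cases hr : r = p
    · subst hr
      rw [Function.update_self]
      exact Submodule.mem_sup_right (Submodule.mem_span_singleton_self v)
    · rw [Function.update_of_ne hr]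
      exact Submodule.mem_sup_left (Submodule.subset_span ⟨r, rfl⟩)
  · refine sup_le ?_ ?_
    · rw [Submodule.span_le]
      rintro _ ⟨r, rfl⟩
      by_cases hr : r = p
      · subst hr
        rw [hp]
        exact Submodule.zero_mem _
      · exact Submodule.subset_span ⟨r, Function.update_of_ne hr _ _⟩
    · rw [Submodule.span_singleton_le_iff_mem]
      exact Submodule.subset_span ⟨p, Function.update_self _ _ _⟩

/-- The situation while `v₀` is reduced by the rows of `B₀`, when the rows before the `p`-th have
been used: `v` is what is left of `v₀`, and `f` tells whether it has been inserted into the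
basis `B`. -/
structure Reduction {n : ℕ} (v₀ : Bits n) (B₀ : Fin n → Bits n) (p : ℕ) (v : Bits n)
    (B : Fin n → Bits n) (f : ℕ) : Prop where
  zero : ∀ q : Fin n, (q : ℕ) < p → v q = 0
  ech : IsEchelon B
  cases : (f = 0 ∧ B = B₀ ∧ v₀ + v ∈ Submodule.span (ZMod 2) (Set.range B₀)) ∨
    (f = 1 ∧ v = 0 ∧ v₀ ∉ Submodule.span (ZMod 2) (Set.range B₀) ∧
      Submodule.span (ZMod 2) (Set.range B) =
        Submodule.span (ZMod 2) (Set.range B₀) ⊔ Submodule.span (ZMod 2) {v₀})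

namespace Reduction

variable {n : ℕ} {v₀ v : Bits n} {B₀ B : Fin n → Bits n} {f : ℕ}

theorem init (h : IsEchelon B₀) : Reduction v₀ B₀ 0 v₀ B₀ 0 :=
  ⟨fun _ h => absurd h (by omega), h, .inl ⟨rfl, rfl, by
    rw [bits_add_self]; exact Submodule.zero_mem _⟩⟩

theorem next_of_zero {p : Fin n} (h : Reduction v₀ B₀ p v B f) (hp : v p = 0) :
    Reduction v₀ B₀ (p + 1) v B f := by
  refine ⟨fun q hq => ?_, h.ech, h.cases⟩
  rcases Nat.lt_succ_iff_lt_or_eq.1 hq with h' | h'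
  · exact h.zero q h'
  · rw [Fin.ext h', hp]

theorem next_of_row {p : Fin n} (h : Reduction v₀ B₀ p v B f) (hp : v p ≠ 0) (hB : B p p ≠ 0) :
    Reduction v₀ B₀ (p + 1) (v + B p) B f := by
  refine ⟨fun q hq => ?_, h.ech, ?_⟩
  · rcases Nat.lt_succ_iff_lt_or_eq.1 hq with h' | h'
    · simp [h.zero q h', (h.ech p).1 q h']
    · rw [Fin.ext h', Pi.add_apply, zmod_two_ne_zero hp, zmod_two_ne_zero hB]; rfl
  · rcases h.cases with ⟨hf, rfl, hv⟩ | ⟨-, hv, -⟩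
    · refine .inl ⟨hf, rfl, ?_⟩
      rw [← add_assoc]
      exact Submodule.add_mem _ hv (Submodule.subset_span ⟨p, rfl⟩)
    · simp [hv] at hp

/-- The remainder becomes row `p` and is then added to itself, so insertion ends with the same
addition as reduction, and the zero remainder makes the later rows idle. `v₀` is outside the span
because `v` is, by `IsEchelon.apply_eq_zero`, and the two differ by an element of it. -/
theorem next_of_insert {p : Fin n} (h : Reduction v₀ B₀ p v B f) (hp : v p ≠ 0) (hB : B p p = 0) :
    Reduction v₀ B₀ (p + 1) (v + v) (Function.update B p v) 1 := by
  refine ⟨fun q hq => by rw [bits_add_self]; rfl, h.ech.update h.zero hp, .inr ?_⟩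
  rcases h.cases with ⟨hf, rfl, hv⟩ | ⟨-, hv, -⟩
  · have hBp := (h.ech p).2 hB
    refine ⟨rfl, bits_add_self _, fun hv₀ => hp ?_, ?_⟩
    · refine h.ech.apply_eq_zero ?_ (fun q hq => h.zero q hq) hBp
      have := Submodule.add_mem _ hv₀ hv
      rwa [← add_assoc, bits_add_self, zero_add] at this
    · rw [span_range_update hBp]
      apply le_antisymm
      · refine sup_le le_sup_left ?_
        rw [Submodule.span_singleton_le_iff_mem]
        have := Submodule.add_mem _ (Submodule.mem_sup_left (T := Submodule.span (ZMod 2) {v₀}) hv)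
          (Submodule.mem_sup_right (Submodule.mem_span_singleton_self v₀))
        rwa [add_right_comm, bits_add_self, zero_add] at this
      · refine sup_le le_sup_left ?_
        rw [Submodule.span_singleton_le_iff_mem]
        have := Submodule.add_mem _ (Submodule.mem_sup_left (T := Submodule.span (ZMod 2) {v}) hv)
          (Submodule.mem_sup_right (Submodule.mem_span_singleton_self v))
        rwa [add_assoc, bits_add_self, add_zero] at this
  · simp [hv] at hp

theorem result (h : Reduction v₀ B₀ n v B f) :
    (f = 0 ∧ B = B₀ ∧ v₀ ∈ Submodule.span (ZMod 2) (Set.range B₀)) ∨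
    (f = 1 ∧ v₀ ∉ Submodule.span (ZMod 2) (Set.range B₀) ∧
      Submodule.span (ZMod 2) (Set.range B) =
        Submodule.span (ZMod 2) (Set.range B₀) ⊔ Submodule.span (ZMod 2) {v₀}) := by
  rcases h.cases with ⟨hf, hB, hv⟩ | ⟨hf, -, h'⟩
  · have : v = 0 := funext fun q => h.zero q q.isLt
    rw [this, add_zero] at hv
    exact .inl ⟨hf, hB, hv⟩
  · exact .inr ⟨hf, h'⟩

end Reduction

/-! ## Vectors and matrices in memory -/

/-- The vector `x` is stored from the address `d` on. -/
def HasVec {n : ℕ} (mem : ℕ → ℕ) (d : ℕ) (x : Bits n) : Prop := ∀ i : Fin n, mem (d + i) = (x i).val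

/-- The rows of the matrix `B` are stored from the address `n` on. -/
def HasMat {n : ℕ} (mem : ℕ → ℕ) (B : Fin n → Bits n) : Prop :=
  ∀ p : Fin n, HasVec mem (n + p * n) (B p)

section

variable {n : ℕ} {mem mem' : ℕ → ℕ} {d e : ℕ} {x v w : Bits n} {B : Fin n → Bits n}

theorem HasVec.congr (h : HasVec mem d x) (h' : ∀ a, d ≤ a → a < d + n → mem' a = mem a) :
    HasVec mem' d x := fun i => (h' _ (by omega) (by omega)).trans (h i)

theorem row_add_lt (p : Fin n) : p * n + n ≤ n * n := by
  have : (p + 1) * n ≤ n * n := Nat.mul_le_mul_right _ p.isLt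
  rwa [add_mul, one_mul] at this

theorem HasMat.congr (h : HasMat mem B) (h' : ∀ a, n ≤ a → a < n + n * n → mem' a = mem a) :
    HasMat mem' B := fun p => (h p).congr fun a ha ha' => h' a (by omega) (by
      have := row_add_lt p; omega)

theorem HasMat.update (h : HasMat mem B) {p : Fin n} (hv : HasVec mem' (n + p * n) v)
    (h' : ∀ a, ¬ (n + p * n ≤ a ∧ a < n + p * n + n) → mem' a = mem a) :
    HasMat mem' (Function.update B p v) := by
  intro q
  by_cases hq : q = p
  · subst hq; rwa [Function.update_self]
  · rw [Function.update_of_ne hq]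
    refine (h q).congr fun a ha ha' => h' a ?_
    rcases lt_or_gt_of_ne (fun h => hq (Fin.ext h) : (q : ℕ) ≠ p) with hlt | hlt
    · have := Nat.mul_le_mul_right n hlt
      rw [Nat.succ_mul] at this
      omega
    · have := Nat.mul_le_mul_right n hlt
      rw [Nat.succ_mul] at this
      omega

theorem val_add_eq_sub (a b : ZMod 2) : (b.val - a.val) + (a.val - b.val) = (a + b).val := by
  revert a b; decide

end

theorem MState.Agree.set {r i x : ℕ} {s s' : MState} (h : s.Agree r s') (hi : r ≤ i) :
    s.Agree r { s' with reg := Function.update s'.reg i x } :=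
  ⟨fun j hj => by
    have : j ≠ i := by omega
    simpa [this] using h.reg j hj, h.buf, h.queries, h.flips⟩

theorem MState.Agree.setMem {r : ℕ} {s s' : MState} (h : s.Agree r s') {m : ℕ → ℕ} :
    s.Agree r { s' with mem := m } := ⟨h.reg, h.buf, h.queries, h.flips⟩

/-! ## Reduction by a basis -/

/-- Reduce the vector at `0` by the basis at `n`, and insert it if it is independent. -/
def reduceStep : Prog :=
  .after [.load 15 11] (.ite 15
    (.after [.add 16 12 11, .load 15 16, .add 14 12 9]
      (.seq (.ite 15 .skip (.seq vecCopy (.instr (.const 13 1)))) vecXor))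
    .skip)

/-- Reduce the vector at `0` by the basis at `n`, and insert it if it is independent; register `13`
tells whether it has been inserted. -/
def reduceVec : Prog :=
  .after [.add 10 2 9, .const 11 0, .add 12 2 9, .const 13 0]
    (.loop 10 (.seq reduceStep (block [.add 11 11 3, .add 12 12 2, .sub 10 10 3])))

section

variable {n₀ n : ℕ} {X : ℕ → Bits n₀} {C : ℕ → Bool} {s : MState} {p q : Prog} {t t₁ t₂ : ℕ}
  {P Q : MState → Prop}

theorem wp_after_of {l : List Instr} (hP : P (l.foldl (fun s a => a.exec X C s) s))
    (h : ∀ s', P s' → wp X C p t Q s') : wp X C (.after l p) (t + 2 * l.length) Q s :=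
  wp_after (h _ hP)

theorem wp_seq_of (hP : wp X C p t₁ P s) (h : ∀ s', P s' → wp X C q t₂ Q s') :
    wp X C (.seq p q) (t₁ + t₂ + 1) Q s :=
  wp_seq (hP.mono le_rfl h)

theorem wp_vecXor_bits {v w : Bits n} (hs : s.Std n) (hv : HasVec s.mem 0 v)
    (hw : HasVec s.mem (s.reg 14) w) :
    wp X C vecXor (22 * n + 5) (fun s' => s.Agree 20 s' ∧ HasVec s'.mem 0 (v + w) ∧
      ∀ a, n ≤ a → s'.mem a = s.mem a) s := by
  refine (wp_vecXor hs).mono le_rfl fun s' ⟨hA, hm⟩ => ⟨hA, fun i => ?_, fun a ha => ?_⟩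
  · have hi := hv i
    rw [zero_add] at hi
    rw [hm, writeVec, if_pos (by omega)]
    simp only [zero_add, Nat.sub_zero, hw i, hi]
    exact val_add_eq_sub _ _
  · rw [hm, writeVec, if_neg (by omega)]

theorem wp_vecCopy_bits {v : Bits n} (hs : s.Std n) (hv : HasVec s.mem 0 v) (hd : n ≤ s.reg 14) :
    wp X C vecCopy (14 * n + 5) (fun s' => s.Agree 20 s' ∧ HasVec s'.mem (s.reg 14) v ∧
      ∀ a, ¬ (s.reg 14 ≤ a ∧ a < s.reg 14 + n) → s'.mem a = s.mem a) s := by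
  refine (wp_vecCopy hs hd).mono le_rfl fun s' ⟨hA, hm⟩ => ⟨hA, fun i => ?_, fun a ha => ?_⟩
  · rw [hm, writeVec, if_pos (by omega)]
    simpa using hv i
  · rw [hm, writeVec, if_neg (by omega)]

theorem wp_vecRead_bits {v : Bits n} (hs : s.Std n) (hv : s.buf = bitSeq v) :
    wp X C vecRead (14 * n + 5) (fun s' => s.Agree 20 s' ∧ HasVec s'.mem (s.reg 14) v ∧
      ∀ a, ¬ (s.reg 14 ≤ a ∧ a < s.reg 14 + n) → s'.mem a = s.mem a) s := by
  refine (wp_vecRead hs).mono le_rfl fun s' ⟨hA, hm⟩ => ⟨hA, fun i => ?_, fun a ha => ?_⟩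
  · rw [hm, writeVec, if_pos (by omega), hv]
    simp [bitSeq]
  · rw [hm, writeVec, if_neg (by omega)]

/-- The cases are those of `next_of_zero`, `next_of_row` and `next_of_insert`, told apart by
coordinate `j` of the remainder and the pivot of row `j`. -/
theorem wp_reduceStep {v₀ v : Bits n} {B₀ B : Fin n → Bits n} {j : Fin n} (hs : s.Std n)
    (h11 : s.reg 11 = j) (h12 : s.reg 12 = n + j * n) (hr : Reduction v₀ B₀ j v B (s.reg 13))
    (hv : HasVec s.mem 0 v) (hB : HasMat s.mem B) :
    wp X C reduceStep (36 * n + 30) (fun s' => s.Agree 13 s' ∧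
      (∃ v' B', Reduction v₀ B₀ (j + 1) v' B' (s'.reg 13) ∧ HasVec s'.mem 0 v' ∧
        HasMat s'.mem B') ∧ ∀ a, n + n * n ≤ a → s'.mem a = s.mem a) s := by
  have hvj : s.mem j = (v j).val := by simpa using hv j
  have hBj : s.mem (n + j * n + j) = (B j j).val := hB j j
  have hjn := row_add_lt j
  refine (wp_after_of (t := 36 * n + 25) (P := fun s' => s.Agree 14 s' ∧ s'.mem = s.mem ∧
    s'.reg 15 = (v j).val) ?_ ?_).le
      (by simp only [List.length_cons, List.length_nil]; omega)
  · simp only [List.foldl, Instr.exec, h11, hvj]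
    exact ⟨(MState.Agree.refl _ _).set (by norm_num), trivial, by simp⟩
  rintro s₁ ⟨hA₁, hm₁, h15⟩
  refine (wp_ite (t := 36 * n + 24) (fun h => ?_) fun h => ?_)
  swap
  · refine (wp_skip ⟨hA₁.mono (by norm_num), ⟨v, B, ?_, ?_, ?_⟩, fun a _ => by rw [hm₁]⟩).le
      (by omega)
    · rw [hA₁.reg _ (by norm_num)]
      exact hr.next_of_zero (by simpa [h15] using h)
    · rwa [hm₁]
    · rwa [hm₁]
  have hvj1 : v j ≠ 0 := by simpa [h15] using h
  refine (wp_after_of (t := 36 * n + 18) (P := fun s' => s.Agree 14 s' ∧ s'.mem = s.mem ∧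
    s'.reg 15 = (B j j).val ∧ s'.reg 14 = n + j * n) ?_ ?_)
  · have e1 := hA₁.reg 11 (by norm_num)
    have e2 := hA₁.reg 12 (by norm_num)
    have e3 := (hs.of_agree hA₁).reg9
    simp only [List.foldl, Instr.exec]
    refine ⟨?_, hm₁, ?_, ?_⟩
    · exact ((hA₁.set (by norm_num)).set (by norm_num)).set (by norm_num)
    · simp [e1, e2, e3, h11, h12, hm₁, hBj]
    · simp [e2, e3, h12]
  rintro s₂ ⟨hA₂, hm₂, h15₂, h14₂⟩
  -- `B'` is the matrix after the optional insertion. In both branches register `14` points to its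
  -- row `j`, so one addition finishes either case.
  refine (wp_seq_of (t₁ := 14 * n + 8) (t₂ := 22 * n + 5) (P := fun s' => s.Agree 13 s' ∧
    s'.reg 14 = n + j * n ∧ (∃ B', Reduction v₀ B₀ (j + 1) (v + B' j) B' (s'.reg 13) ∧
      HasMat s'.mem B') ∧ HasVec s'.mem 0 v ∧ ∀ a, n + n * n ≤ a → s'.mem a = s.mem a) ?_ ?_).le
      (by omega)
  · refine (wp_ite (t := 14 * n + 7) (fun h => ?_) fun h => ?_)
    · refine (wp_skip ⟨hA₂.mono (by norm_num), h14₂, ⟨B, ?_, by rwa [hm₂]⟩, by rwa [hm₂],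
        fun a _ => by rw [hm₂]⟩).le (by omega)
      rw [hA₂.reg _ (by norm_num)]
      exact hr.next_of_row hvj1 (by simpa [h15₂] using h)
    · refine (wp_seq_of (t₁ := 14 * n + 5) (t₂ := 1) (wp_vecCopy_bits (v := v) (hs.of_agree hA₂) (by rwa [hm₂])
        (by rw [h14₂]; omega)) ?_)
      rintro s₃ ⟨hA₃, hv₃, hm₃⟩
      refine wp_instr ⟨?_, ?_, ⟨Function.update B j v, ?_, ?_⟩, ?_, ?_⟩
      · exact ((hA₂.mono (by norm_num)).trans (hA₃.mono (by norm_num))).set (by norm_num)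
      · simp [Instr.exec, hA₃.reg 14, h14₂]
      · simp only [Instr.exec, Function.update_self]
        exact hr.next_of_insert hvj1 (by simpa [h15₂] using h)
      · simp only [Instr.exec]
        rw [h14₂] at hv₃ hm₃
        exact hB.update hv₃ fun a ha => (hm₃ a ha).trans (by rw [hm₂])
      · refine hv.congr fun a ha ha' => ?_
        simp only [Instr.exec]
        rw [hm₃ _ (by omega), hm₂]
      · intro a ha
        simp only [Instr.exec]
        rw [hm₃ _ (by omega), hm₂]
  · rintro s₃ ⟨hA₃, h14₃, ⟨B', hr', hB'⟩, hv₃, hm₃⟩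
    refine (wp_vecXor_bits (hs.of_agree hA₃) hv₃ (w := B' j) (by rw [h14₃]; exact hB' j)).mono
      le_rfl ?_
    rintro s₄ ⟨hA₄, hv₄, hm₄⟩
    refine ⟨hA₃.trans (hA₄.mono (by norm_num)), ⟨v + B' j, B', ?_, hv₄, ?_⟩, ?_⟩
    · rwa [hA₄.reg _ (by norm_num)]
    · exact hB'.congr fun a ha _ => hm₄ a ha
    · exact fun a ha => (hm₄ a (by omega)).trans (hm₃ a ha)

theorem wp_reduceVec {v : Bits n} {B : Fin n → Bits n} (hs : s.Std n) (hE : IsEchelon B)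
    (hv : HasVec s.mem 0 v) (hB : HasMat s.mem B) :
    wp X C reduceVec (36 * n * n + 40 * n + 9) (fun s' => s.Agree 10 s' ∧
      (∃ v' B', Reduction v B n v' B' (s'.reg 13) ∧ HasVec s'.mem 0 v' ∧ HasMat s'.mem B') ∧
        ∀ a, n + n * n ≤ a → s'.mem a = s.mem a) s := by
  refine (wp_after (wp_loop (t := 36 * n + 38) (fun j s' => s.Agree 10 s' ∧ s'.reg 10 = n - j ∧
    s'.reg 11 = j ∧ s'.reg 12 = n + j * n ∧
    (∃ v' B', Reduction v B j v' B' (s'.reg 13) ∧ HasVec s'.mem 0 v' ∧ HasMat s'.mem B') ∧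
        ∀ a, n + n * n ≤ a → s'.mem a = s.mem a) n ?_ ?_ ?_)).mono ?_ ?_
  · rintro j s₁ hj ⟨hA₁, h10, h11, h12, ⟨v', B', hr, hv', hB'⟩, hm⟩
    refine ⟨by omega, (wp_seq_of (wp_reduceStep (j := ⟨j, hj⟩) (hs.of_agree hA₁) h11 h12 hr
      hv' hB') ?_).le (t₁ := 36 * n + 30 + 7 + 1) (by omega)⟩
    rintro s₂ ⟨hA₂, hex, hm₂⟩
    refine wp_block ?_
    have e2 := ((hs.of_agree hA₁).of_agree hA₂)
    have e10 := (hA₂.reg 10 (by norm_num)).trans h10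
    have e11 := (hA₂.reg 11 (by norm_num)).trans h11
    have e12 := (hA₂.reg 12 (by norm_num)).trans h12
    simp only [List.foldl, Instr.exec]
    refine ⟨?_, ?_, ?_, ?_, ?_, ?_⟩
    · exact (((hA₁.trans (hA₂.mono (by norm_num))).set (by norm_num)).set (by norm_num)).set
        (by norm_num)
    · simp [e10, e2.reg3]; omega
    · simp [e11, e2.reg3]
    · simp [e12, e2.reg2]; ring
    · simpa using hex
    · exact fun a ha => (hm₂ a ha).trans (hm a ha)
  · rintro s₁ ⟨-, h10, -⟩
    simpa using h10
  · simp only [List.foldl, Instr.exec]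
    refine ⟨?_, ?_, ?_, ?_, ⟨v, B, ?_, hv, hB⟩, by simp⟩
    · exact ((((MState.Agree.refl _ _).set (by norm_num)).set (by norm_num)).set (by norm_num)).set
        (by norm_num)
    · simp [hs.reg2, hs.reg9]
    · simp
    · simp [hs.reg2, hs.reg9]
    · simpa using Reduction.init hE
  · simp only [List.length_cons, List.length_nil]
    nlinarith
  · rintro s' ⟨hA, -, -, -, h, hm⟩
    exact ⟨hA, h, hm⟩

end

/-! ## Gaussian elimination -/

/-- The state after the elimination has processed the first `k` samples, where `m` columns `R` have
been found so far. -/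
structure GaussState {n : ℕ} (X : ℕ → Bits n) (k m : ℕ) (R : Fin m → Bits n) (B : Fin n → Bits n)
    (s : MState) : Prop where
  std : s.Std n
  reg4 : s.reg 4 = n + n * n
  reg5 : s.reg 5 = m
  reg6 : s.reg 6 = n + n * n + (m + 1) * n
  queries : s.queries = k
  ech : IsEchelon B
  basis : HasMat s.mem B
  base : HasVec s.mem (n + n * n) (X 0)
  cols : ∀ j : Fin m, HasVec s.mem (n + n * n + (j + 1) * n) (R j)
  indep : LinearIndependent (ZMod 2) R
  isSample : ∀ j, ∃ l < k, R j = X l + X 0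
  mem_span : ∀ l < k, X l + X 0 ∈ Submodule.span (ZMod 2) (Set.range R)
  span_eq : Submodule.span (ZMod 2) (Set.range B) = Submodule.span (ZMod 2) (Set.range R)

/-- Process a sample. -/
def sampleStep : Prog :=
  .after [.query, .const 14 0] (.seq vecRead (.after [.add 14 4 9] (.seq vecXor
    (.after [.add 14 6 9] (.seq vecCopy (.seq reduceVec
      (.seq (.ite 13 (block [.add 5 5 3, .add 6 6 2]) .skip) (.instr (.sub 7 7 3)))))))))

/-- Put the number `n + ⌈log₂ D⌉` of the further samples into register `7`, and the address
`n + n * n` into register `4`. -/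
def gaussInit : Prog :=
  .after [.const 9 0, .const 3 1, .add 2 0 9, .const 8 1, .add 7 2 9, .sub 14 1 8]
    (.seq (.loop 14 (block [.add 8 8 8, .add 7 7 3, .sub 14 1 8]))
      (.after [.add 4 2 9, .add 10 2 9] (.loop 10 (block [.add 4 4 2, .sub 10 10 3]))))

/-- Gaussian elimination, given `n` and `D` in the registers `0` and `1`. -/
def gauss : Prog :=
  .seq gaussInit (.seq (.after [.const 5 0, .add 6 4 2, .query, .add 14 4 9] vecRead)
    (.seq (.loop 7 sampleStep) (block [.add 0 5 9, .add 1 4 9])))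

section

variable {n : ℕ} {X : ℕ → Bits n} {C : ℕ → Bool} {s : MState}

/-- The reduction destroys the difference, so a copy is first put into the next column slot.
Registers `5` and `6` advance only if the vector was independent; otherwise the slot is reused. -/
theorem wp_sampleStep {k m : ℕ} {R : Fin m → Bits n} {B : Fin n → Bits n}
    (h : GaussState X k m R B s) :
    wp X C sampleStep (36 * n * n + 90 * n + 60) (fun s' => s'.reg 7 = s.reg 7 - 1 ∧
      ∃ m' R' B', GaussState X (k + 1) m' R' B' s') s := by
  have hs := h.std
  -- A query changes the buffer and the sample count, so both are reset for the comparison of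
  -- registers.
  refine (wp_after_of (t := 36 * n * n + 90 * n + 56) (P := fun s' => s.Agree 10
      { s' with buf := s.buf, queries := s.queries } ∧
    s'.mem = s.mem ∧ s'.reg 14 = 0 ∧ s'.queries = k + 1 ∧ s'.buf = bitSeq (X k)) ?_ ?_)
  · simp only [List.foldl, Instr.exec, h.queries]
    refine ⟨⟨fun i hi => ?_, rfl, h.queries.symm, rfl⟩, trivial, by simp, trivial, trivial⟩
    have : i ≠ 14 := by omega
    simp [this]
  rintro s₁ ⟨hA₁, hm₁, h14₁, hq₁, hb₁⟩
  have hr₁ : ∀ i < 10, s₁.reg i = s.reg i := hA₁.reg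
  have hs₁ : s₁.Std n := ⟨(hr₁ 2 (by norm_num)).trans hs.reg2, (hr₁ 3 (by norm_num)).trans hs.reg3,
    (hr₁ 9 (by norm_num)).trans hs.reg9⟩
  clear hA₁
  refine (wp_seq_of (t₁ := 14 * n + 5) (t₂ := 36 * n * n + 76 * n + 50)
    (wp_vecRead_bits hs₁ hb₁) ?_).le (by omega)
  rintro s₂ ⟨hA₂, hv₂, hm₂⟩
  rw [h14₁] at hv₂ hm₂
  have h4 : s₂.reg 4 = n + n * n :=
    ((hA₂.reg 4 (by norm_num)).trans (hr₁ 4 (by norm_num))).trans h.reg4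
  refine (wp_after_of (t := 36 * n * n + 76 * n + 48) (P := fun s' => s₁.Agree 14 s' ∧
    s'.mem = s₂.mem ∧ s'.reg 14 = n + n * n) ?_ ?_)
  · simp only [List.foldl, Instr.exec]
    exact ⟨(hA₂.mono (by norm_num)).set (by norm_num), trivial,
      by simp [h4, (hs₁.of_agree hA₂).reg9]⟩
  rintro s₃ ⟨hA₃, hm₃, h14₃⟩
  have hbase : HasVec s₂.mem (n + n * n) (X 0) := by
    refine h.base.congr fun a ha ha' => ?_
    rw [hm₂ _ (by omega), hm₁]
  refine (wp_seq_of (t₁ := 22 * n + 5) (t₂ := 36 * n * n + 54 * n + 40)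
    (wp_vecXor_bits (v := X k) (w := X 0) (hs₁.of_agree hA₃) (by rwa [hm₃])
      (by rwa [hm₃, h14₃])) ?_).le (by omega)
  rintro s₄ ⟨hA₄, hv₄, hm₄⟩
  have h6 : s₄.reg 6 = n + n * n + (m + 1) * n :=
    (((hA₄.reg 6 (by norm_num)).trans (hA₃.reg 6 (by norm_num))).trans
      (hr₁ 6 (by norm_num))).trans h.reg6
  have hmem₄ : ∀ a, n ≤ a → s₄.mem a = s.mem a := fun a ha => by
    rw [hm₄ a ha, hm₃, hm₂ _ (by omega), hm₁]
  have hs₄ := (hs₁.of_agree hA₃).of_agree hA₄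
  refine (wp_after_of (t := 36 * n * n + 54 * n + 38) (P := fun s' => s₁.Agree 14 s' ∧
    s'.mem = s₄.mem ∧ s'.reg 14 = n + n * n + (m + 1) * n) ?_ ?_)
  · simp only [List.foldl, Instr.exec]
    exact ⟨(hA₃.trans (hA₄.mono (by norm_num))).set (by norm_num), trivial,
      by simp [h6, hs₄.reg9]⟩
  rintro s₅ ⟨hA₅, hm₅, h14₅⟩
  have hs₅ := hs₁.of_agree hA₅
  refine (wp_seq_of (t₁ := 14 * n + 5) (t₂ := 36 * n * n + 40 * n + 30)
    (wp_vecCopy_bits (v := X k + X 0) hs₅ (by rwa [hm₅]) (by rw [h14₅]; omega)) ?_).le (by omega)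
  rintro s₆ ⟨hA₆, hv₆, hm₆⟩
  rw [h14₅] at hv₆ hm₆
  have hs₆ := hs₅.of_agree hA₆
  have hmn : n ≤ (m + 1) * n := Nat.le_mul_of_pos_left n (by omega)
  have hmem₆ : ∀ a, n ≤ a → a < n + n * n + (m + 1) * n → s₆.mem a = s.mem a := fun a ha ha' => by
    rw [hm₆ _ (by omega), hm₅, hmem₄ a ha]
  refine (wp_seq_of (t₁ := 36 * n * n + 40 * n + 9) (t₂ := 8)
    (wp_reduceVec (v := X k + X 0) (B := B) hs₆ h.ech ?_ ?_) ?_).le (by omega)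
  · refine hv₄.congr fun a ha ha' => ?_
    rw [hm₆ _ (by omega), hm₅]
  · exact h.basis.congr fun a ha ha' => hmem₆ a ha (by omega)
  rintro s₇ ⟨hA₇, ⟨v', B', hred, -, hB'⟩, hm₇⟩
  have hs₇ := hs₆.of_agree hA₇
  have hr₇ : ∀ i < 10, s₇.reg i = s.reg i := fun i hi =>
    (((hA₇.reg i hi).trans (hA₆.reg i (by omega))).trans (hA₅.reg i (by omega))).trans (hr₁ i hi)
  have hq₇ : s₇.queries = k + 1 :=
    ((hA₇.queries.trans hA₆.queries).trans hA₅.queries).trans hq₁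
  have hv₇ : HasVec s₇.mem (n + n * n + (m + 1) * n) (X k + X 0) :=
    hv₆.congr fun a ha ha' => hm₇ a (by omega)
  have hmem₇ : ∀ a, n + n * n ≤ a → a < n + n * n + (m + 1) * n → s₇.mem a = s.mem a :=
    fun a ha ha' => (hm₇ a ha).trans (hmem₆ a (by omega) ha')
  have hbase₇ : HasVec s₇.mem (n + n * n) (X 0) :=
    h.base.congr fun a ha ha' => hmem₇ a ha (by omega)
  have hcols₇ : ∀ j : Fin m, HasVec s₇.mem (n + n * n + (j + 1) * n) (R j) := fun j => by
    refine (h.cols j).congr fun a ha ha' => hmem₇ a (by omega) ?_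
    have := Nat.mul_le_mul_right n (Nat.succ_le_succ j.isLt)
    simp only [Nat.succ_eq_add_one, add_mul, one_mul] at this ha' ⊢
    omega
  have e5 := (hr₇ 5 (by norm_num)).trans h.reg5
  have e6 := (hr₇ 6 (by norm_num)).trans h.reg6
  have e4 := (hr₇ 4 (by norm_num)).trans h.reg4
  have e7 := hr₇ 7 (by norm_num)
  refine (wp_seq_of (t₁ := 6) (t₂ := 1) (P := fun s' => s'.reg 7 = s.reg 7 ∧
    ∃ m' R' B', GaussState X (k + 1) m' R' B' s')
    (wp_ite (t := 5) (fun h13 => ?_) fun h13 => ?_) ?_)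
  · rcases hred.result with ⟨hf, -⟩ | ⟨-, hnot, hspan⟩
    · exact absurd hf h13
    refine wp_block ?_
    simp only [List.foldl, Instr.exec]
    have hsnoc : Set.range (Fin.snoc R (X k + X 0) : Fin (m + 1) → Bits n) =
        insert (X k + X 0) (Set.range R) := Fin.range_snoc _ _
    have hspan' : Submodule.span (ZMod 2) (Set.range (Fin.snoc R (X k + X 0) :
        Fin (m + 1) → Bits n)) = Submodule.span (ZMod 2) (Set.range B') := by
      rw [hsnoc, hspan, h.span_eq, Submodule.span_insert, sup_comm]
    refine ⟨by simp [e7], m + 1, Fin.snoc R (X k + X 0), B',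
      ⟨⟨by simp [hs₇.reg2], by simp [hs₇.reg3], by simp [hs₇.reg9]⟩, by simp [e4],
        by simp [e5, hs₇.reg3], ?_, hq₇, hred.ech, hB', hbase₇, ?_, ?_, ?_, ?_, hspan'.symm⟩⟩
    · simp [e6, hs₇.reg2]; ring
    · intro j
      refine Fin.lastCases ?_ (fun j => ?_) j
      · simpa using hv₇
      · simpa using hcols₇ j
    · exact linearIndependent_finSnoc.2 ⟨h.indep, by rwa [← h.span_eq]⟩
    · intro j
      refine Fin.lastCases ?_ (fun j => ?_) j
      · exact ⟨k, by omega, by simp⟩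
      · obtain ⟨l, hl, hR⟩ := h.isSample j
        exact ⟨l, by omega, by simpa using hR⟩
    · intro l hl
      rw [hsnoc]
      rcases Nat.lt_succ_iff_lt_or_eq.1 hl with hl | rfl
      · exact Submodule.span_mono (Set.subset_insert _ _) (h.mem_span l hl)
      · exact Submodule.subset_span (Set.mem_insert _ _)
  · rcases hred.result with ⟨-, rfl, hmem⟩ | ⟨hf, -⟩
    swap
    · rw [hf] at h13; exact absurd h13 one_ne_zero
    refine (wp_skip ⟨e7, m, R, B', ⟨hs₇, e4, e5, e6, hq₇, hred.ech, hB', hbase₇, hcols₇, h.indep,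
      fun j => ?_, fun l hl => ?_, h.span_eq⟩⟩).le (by norm_num)
    · obtain ⟨l, hl, hR⟩ := h.isSample j
      exact ⟨l, by omega, hR⟩
    · rcases Nat.lt_succ_iff_lt_or_eq.1 hl with hl | rfl
      · exact h.mem_span l hl
      · rwa [← h.span_eq]
  · rintro s₈ ⟨h7, m', R', B'', h'⟩
    refine wp_instr ?_
    simp only [Instr.exec]
    exact ⟨by simp [h7, h'.std.reg3], m', R', B'',
      ⟨⟨by simp [h'.std.reg2], by simp [h'.std.reg3], by simp [h'.std.reg9]⟩, by simp [h'.reg4],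
        by simp [h'.reg5], by simp [h'.reg6], h'.queries, h'.ech, h'.basis, h'.base, h'.cols,
        h'.indep, h'.isSample, h'.mem_span, h'.span_eq⟩⟩

/-- The logarithm is found by doubling until `D` is reached, with one more sample per doubling, and
`n * n` by repeated addition. There are at most `D` doublings, which keeps the time polynomial in `1
/ δ`. -/
theorem wp_gaussInit {D : ℕ} (h0 : s.reg 0 = n) (h1 : s.reg 1 = D) :
    wp X C gaussInit (8 * (n + D) + 40) (fun s' => s'.Std n ∧ s'.reg 4 = n + n * n ∧
      s'.reg 7 = n + Nat.clog 2 D ∧ s'.mem = s.mem ∧ s'.queries = s.queries) s := by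
  have hclog : Nat.clog 2 D ≤ D := Nat.clog_le_of_le_pow Nat.lt_two_pow_self.le
  refine (wp_after_of (t := 8 * (n + D) + 28) (P := fun s' => s'.Std n ∧ s'.reg 1 = D ∧
    s'.reg 8 = 1 ∧ s'.reg 7 = n ∧ s'.reg 14 = D - 1 ∧ s'.mem = s.mem ∧ s'.queries = s.queries)
    ?_ ?_).le (by simp only [List.length_cons, List.length_nil]; omega)
  · simp only [List.foldl, Instr.exec]
    exact ⟨⟨by simp [h0], by simp, by simp⟩, by simp [h1], by simp, by simp [h0], by simp [h1],
      trivial, trivial⟩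
  rintro s₁ ⟨hs₁, e1, e8, e7, e14, hm₁, hq₁⟩
  refine (wp_seq_of (t₁ := Nat.clog 2 D * 8 + 1) (t₂ := n * 6 + 5) (wp_loop (t := 7)
    (fun j s' => s'.Std n ∧ s'.reg 1 = D ∧ s'.reg 8 = 2 ^ j ∧ s'.reg 7 = n + j ∧
      s'.reg 14 = D - 2 ^ j ∧ s'.mem = s.mem ∧ s'.queries = s.queries) _ ?_ ?_ ?_) ?_).le (by omega)
  · rintro j s₂ hj ⟨hs, e1, e8, e7, e14, hm, hq⟩
    have := (Nat.lt_clog_iff_pow_lt (by norm_num)).1 hj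
    refine ⟨by omega, wp_block ?_⟩
    simp only [List.foldl, Instr.exec]
    exact ⟨⟨by simp [hs.reg2], by simp [hs.reg3], by simp [hs.reg9]⟩, by simp [e1],
      by simp [e8]; ring, by simp [e7, hs.reg3]; ring, by simp [e8, e1, pow_succ, mul_two], hm, hq⟩
  · rintro s₂ ⟨-, -, -, -, e14, -⟩
    rw [e14]
    exact Nat.sub_eq_zero_of_le (Nat.le_pow_clog (by norm_num) D)
  · exact ⟨hs₁, e1, by simpa using e8, by simpa using e7, by simpa using e14, hm₁, hq₁⟩
  · rintro s₂ ⟨hs₂, -, -, e7, -, hm₂, hq₂⟩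
    refine (wp_after (t := n * 6 + 1) ((wp_loop (t := 5) (fun j s' => s'.Std n ∧
      s'.reg 10 = n - j ∧ s'.reg 4 = n + j * n ∧ s'.reg 7 = n + Nat.clog 2 D ∧ s'.mem = s.mem ∧
      s'.queries = s.queries) n ?_ ?_ ?_).mono (by omega) ?_))
    · rintro j s₂ hj ⟨hs, e10, e4, e7, hm, hq⟩
      refine ⟨by omega, wp_block ?_⟩
      simp only [List.foldl, Instr.exec]
      exact ⟨⟨by simp [hs.reg2], by simp [hs.reg3], by simp [hs.reg9]⟩,
        by simp [e10, hs.reg3]; omega, by simp [e4, hs.reg2]; ring, by simp [e7], hm, hq⟩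
    · rintro s₂ ⟨-, e10, -⟩
      simpa using e10
    · simp only [List.foldl, Instr.exec]
      exact ⟨⟨by simp [hs₂.reg2], by simp [hs₂.reg3], by simp [hs₂.reg9]⟩,
        by simp [hs₂.reg2, hs₂.reg9], by simp [hs₂.reg2, hs₂.reg9], by simp [e7], hm₂, hq₂⟩
    · rintro s' ⟨hs, -, e4, e7, hm, hq⟩
      exact ⟨hs, e4, e7, hm, hq⟩

theorem wp_gauss {D : ℕ} (h0 : s.reg 0 = n) (h1 : s.reg 1 = D) (hm : s.mem = 0)
    (hq : s.queries = 0) :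
    wp X C gauss (200 * (n + D + 1) ^ 3) (fun s' => ∃ m R B,
      s'.reg 0 = m ∧ s'.reg 1 = n + n * n ∧
      GaussState X (n + 1 + Nat.clog 2 D) m R B s') s := by
  have hclog : Nat.clog 2 D ≤ D := Nat.clog_le_of_le_pow Nat.lt_two_pow_self.le
  have htime : 8 * (n + D) + 40 + ((14 * n + 5 + 2 * 4) +
      (((n + Nat.clog 2 D) * (36 * n * n + 90 * n + 60 + 1) + 1) + 5 + 1) + 1) + 1 ≤
      200 * (n + D + 1) ^ 3 := by
    have h2 : (n + Nat.clog 2 D) * (36 * n * n + 90 * n + 60 + 1) ≤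
        (n + D) * (36 * n * n + 90 * n + 60 + 1) := Nat.mul_le_mul_right _ (by omega)
    have h3 : (n + D) * (36 * n * n + 90 * n + 60 + 1) ≤
        (n + D) * (36 * (n + D) * (n + D) + 90 * (n + D) + 60 + 1) := by gcongr <;> omega
    have h4 : 14 * n ≤ 14 * (n + D) := by omega
    generalize n + D = N at *
    ring_nf at *
    omega
  refine (wp_seq_of (wp_gaussInit h0 h1) ?_).le htime
  rintro s₁ ⟨hs₁, h4, h7, hm₁, hq₁⟩
  rw [hm] at hm₁
  rw [hq] at hq₁
  -- The first sample is the base point. Its difference to itself is zero, so the invariant starts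
  -- with one sample, no columns and the zero matrix.
  refine wp_seq_of (P := fun s' => s'.reg 7 = n + Nat.clog 2 D ∧
    ∃ m R B, GaussState X 1 m R B s')
    (wp_after_of (P := fun s' => s'.Std n ∧ s'.reg 4 = n + n * n ∧ s'.reg 5 = 0 ∧
      s'.reg 6 = n + n * n + n ∧ s'.reg 7 = n + Nat.clog 2 D ∧ s'.reg 14 = n + n * n ∧
      s'.queries = 1 ∧ s'.buf = bitSeq (X 0) ∧ s'.mem = 0) ?_ ?_) ?_
  · simp only [List.foldl, Instr.exec]
    exact ⟨⟨by simp [hs₁.reg2], by simp [hs₁.reg3], by simp [hs₁.reg9]⟩, by simp [h4], by simp,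
      by simp [h4, hs₁.reg2], by simp [h7], by simp [h4, hs₁.reg9], by simp [hq₁], by simp [hq₁],
      hm₁⟩
  · rintro s₂ ⟨hs₂, h4, h5, h6, h7, h14, hq₂, hb₂, hm₂⟩
    refine (wp_vecRead_bits hs₂ hb₂).mono le_rfl ?_
    rintro s₃ ⟨hA₃, hv₃, hm₃⟩
    rw [h14] at hv₃ hm₃
    rw [hm₂] at hm₃
    refine ⟨(hA₃.reg 7 (by norm_num)).trans h7, 0, Fin.elim0, 0, hs₂.of_agree hA₃,
      (hA₃.reg 4 (by norm_num)).trans h4, (hA₃.reg 5 (by norm_num)).trans h5,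
      (hA₃.reg 6 (by norm_num)).trans (by rw [h6]; ring), hA₃.queries.trans hq₂, isEchelon_zero,
      fun p i => ?_, hv₃, fun j => j.elim0, linearIndependent_empty_type, fun j => j.elim0,
      fun l hl => ?_, ?_⟩
    · have := row_add_lt p
      rw [hm₃ _ (by omega)]
      rfl
    · obtain rfl : l = 0 := by omega
      rw [bits_add_self]
      exact Submodule.zero_mem _
    · rw [Set.range_eq_empty (Fin.elim0 : Fin 0 → Bits n), Submodule.span_empty, Submodule.span_eq_bot]
      rintro _ ⟨p, rfl⟩
      rfl
  · rintro s₂ ⟨h7, m, R, B, hG⟩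
    refine wp_seq_of (t₁ := (n + Nat.clog 2 D) * (36 * n * n + 90 * n + 60 + 1) + 1) (t₂ := 5)
      (wp_loop (fun j s' => s'.reg 7 = n + Nat.clog 2 D - j ∧
      ∃ m R B, GaussState X (j + 1) m R B s') (n + Nat.clog 2 D) ?_ ?_ ?_) ?_
    · rintro j s₃ hj ⟨h7, m, R, B, hG⟩
      refine ⟨by omega, (wp_sampleStep hG).mono le_rfl ?_⟩
      rintro s₄ ⟨h7', h'⟩
      exact ⟨by omega, h'⟩
    · rintro s₃ ⟨h7, -⟩
      simpa using h7
    · exact ⟨h7, m, R, B, hG⟩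
    · rintro s₃ ⟨-, m, R, B, h'⟩
      refine wp_block ?_
      simp only [List.foldl, Instr.exec]
      exact ⟨m, R, B, by simp [h'.reg5, h'.std.reg9], by simp [h'.reg4, h'.std.reg9],
        ⟨⟨by simp [h'.std.reg2], by simp [h'.std.reg3], by simp [h'.std.reg9]⟩, by simp [h'.reg4],
        by simp [h'.reg5], by simp [h'.reg6], by rw [h'.queries]; ring, h'.ech, h'.basis, h'.base,
        h'.cols, h'.indep, fun j => (h'.isSample j).imp fun l hl => ⟨by omega, hl.2⟩,
        fun l hl => h'.mem_span l (by omega), h'.span_eq⟩⟩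

end

/-! ## Random samples from an affine subspace -/

section

variable {n : ℕ}

/-- Powers of two are integers, so they bound `y` exactly if they bound its ceiling. The number of
samples can therefore be computed from `⌈1 / δ⌉` alone. -/
theorem ceil_logb_two {y : ℝ} (hy : 0 < y) : ⌈Real.logb 2 y⌉₊ = Nat.clog 2 ⌈y⌉₊ := by
  refine eq_of_forall_ge_iff fun m => ?_
  rw [Nat.ceil_le, Nat.clog_le_iff_le_pow (by norm_num), Nat.ceil_le,
    Real.logb_le_iff_le_rpow (by norm_num) hy]
  simp

/-- A single constant has to serve as factor and as exponent. Rounding costs the factor `3`, since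
`⌈y⌉ < y + 1` and `1 ≤ z`. -/
theorem poly_le_floor {K e : ℕ} {y z : ℝ} (hy : 1 < y) (hz : n + y ≤ z) :
    K * (n + ⌈y⌉₊ + 1) ^ e ≤ ⌊((K * 3 ^ e + e : ℕ) : ℝ) * z ^ (K * 3 ^ e + e)⌋₊ := by
  have hn : (0 : ℝ) ≤ n := n.cast_nonneg
  have hz1 : 1 ≤ z := by linarith
  refine Nat.le_floor ?_
  push_cast
  have h1 : (n : ℝ) + ⌈y⌉₊ + 1 ≤ 3 * z := by
    have := Nat.ceil_lt_add_one (by linarith : (0 : ℝ) ≤ y)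
    linarith
  calc (K : ℝ) * (n + ⌈y⌉₊ + 1) ^ e ≤ K * (3 * z) ^ e := by gcongr
    _ = (K * 3 ^ e) * z ^ e := by rw [mul_pow]; ring
    _ ≤ (K * 3 ^ e + e) * z ^ (K * 3 ^ e + e) := by
        gcongr
        · exact le_add_of_nonneg_right e.cast_nonneg
        · omega

theorem IsUniformOn.apply_add {P : PMF (Bits n)} {A : AffineSubspace (ZMod 2) (Bits n)}
    (hP : IsUniformOn P A) {v : Bits n} (hv : v ∈ A.direction) (x : Bits n) : P (x + v) = P x := by
  rw [← ENNReal.toReal_eq_toReal_iff' (P.apply_ne_top _) (P.apply_ne_top _)]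
  have h : x + v ∈ A ↔ x ∈ A := by
    rw [add_comm]
    exact AffineSubspace.vadd_mem_iff_mem_of_mem_direction hv
  by_cases hx : x ∈ A
  · rw [hP.2.1 _ hx, hP.2.1 _ (h.2 hx)]
  · rw [hP.2.2 _ hx, hP.2.2 _ (mt h.1 hx)]

/-- Translation by `v` preserves `P` and exchanges the two level sets of the functional. -/
theorem IsUniformOn.measure_dotProduct {P : PMF (Bits n)} {A : AffineSubspace (ZMod 2) (Bits n)}
    (hP : IsUniformOn P A) {u v : Bits n} (hv : v ∈ A.direction) (huv : u ⬝ᵥ v ≠ 0) (c : ZMod 2) :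
    P.toMeasure {x | u ⬝ᵥ x = c} = 2⁻¹ := by
  have hshift : P.toMeasure {x | u ⬝ᵥ x = c + 1} = P.toMeasure {x | u ⬝ᵥ x = c} := by
    rw [PMF.toMeasure_apply_fintype, PMF.toMeasure_apply_fintype,
      ← Equiv.sum_comp (Equiv.addRight v)]
    refine Finset.sum_congr rfl fun x _ => ?_
    simp only [Set.indicator_apply, Set.mem_ofPred_eq, Equiv.coe_addRight, dotProduct_add,
      zmod_two_ne_zero huv, add_left_inj, hP.apply_add hv]
  have hcompl : {x : Bits n | u ⬝ᵥ x = c}ᶜ = {x | u ⬝ᵥ x = c + 1} := by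
    ext x
    have : ∀ a b : ZMod 2, ¬ a = b ↔ a = b + 1 := by decide
    exact this _ _
  have h := measure_add_measure_compl (μ := P.toMeasure)
    (MeasurableSet.of_discrete (s := {x : Bits n | u ⬝ᵥ x = c}))
  rw [hcompl, hshift, measure_univ, ← two_mul] at h
  rw [mul_comm] at h
  exact ENNReal.eq_inv_of_mul_eq_one_left h

instance (P : PMF (Bits n)) : IsProbabilityMeasure (sampleMeasure P) := by
  unfold sampleMeasure; infer_instance

instance : IsProbabilityMeasure coinMeasure := by
  unfold coinMeasure; infer_instance

theorem sampleMeasure_forall_mem (P : PMF (Bits n)) (s : Set (Bits n)) (k : ℕ) :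
    sampleMeasure P {X | ∀ l < k, X l ∈ s} = P.toMeasure s ^ k := by
  have : {X : ℕ → Bits n | ∀ l < k, X l ∈ s} = (↑(Finset.range k) : Set ℕ).pi fun _ => s := by
    ext X; simp
  rw [this, sampleMeasure, Measure.infinitePi_pi _ fun _ _ => MeasurableSet.of_discrete]
  simp

/-- The samples `X 0, …, X (k - 1)` lie in `A`, and their differences span its direction. -/
def Spans (A : AffineSubspace (ZMod 2) (Bits n)) (k : ℕ) (X : ℕ → Bits n) : Prop :=
  (∀ l < k, X l ∈ A) ∧
    A.direction ≤ Submodule.span (ZMod 2) {y | ∃ l < k, y = X l + X 0}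

-- If the differences do not span, a functional that is not constant on `A` takes one value on all
-- samples. `U` is the union of these events over all functionals and values, together with a null
-- event. Prescribing the value, instead of comparing with the first sample, makes the events
-- products; it doubles their number, hence the `1` in `n + 1 + N`. Only `U` has to be measurable,
-- not `S`.
open Classical in
theorem le_measure_of_spans {P : PMF (Bits n)} {A : AffineSubspace (ZMod 2) (Bits n)}
    (hP : IsUniformOn P A) {N : ℕ} {S : Set ((ℕ → Bits n) × (ℕ → Bool))}
    (hS : ∀ ω : (ℕ → Bits n) × (ℕ → Bool), Spans A (n + 1 + N) ω.1 → ω ∈ S) :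
    1 - ((2 : ℝ) ^ N)⁻¹ ≤ (learnerMeasure P).real S := by
  set k := n + 1 + N with hk
  let I : Finset (Bits n × ZMod 2) :=
    Finset.univ.filter fun i => ∃ v ∈ A.direction, i.1 ⬝ᵥ v ≠ 0
  let U : Set (ℕ → Bits n) := (⋃ l : ℕ, {X | X l ∉ A}) ∪
    ⋃ i ∈ I, {X | ∀ l < k, X l ∈ {x | i.1 ⬝ᵥ x = i.2}}
  have hmeas : MeasurableSet U := by
    refine MeasurableSet.union (MeasurableSet.iUnion fun l => ?_)
      (Finset.measurableSet_biUnion _ fun i _ => ?_)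
    · have hl : Measurable fun X : ℕ → Bits n => X l := measurable_pi_apply l
      exact hl (MeasurableSet.of_discrete (s := {x : Bits n | x ∉ A}))
    · simp only [Set.ofPred_forall]
      refine MeasurableSet.iInter fun l => MeasurableSet.iInter fun _ => ?_
      have hl : Measurable fun X : ℕ → Bits n => X l := measurable_pi_apply l
      exact hl (MeasurableSet.of_discrete (s := {x : Bits n | i.1 ⬝ᵥ x = i.2}))
  have hU : sampleMeasure P U ≤ (2 ^ N)⁻¹ := by
    refine (measure_union_le _ _).trans ?_
    have h0 : sampleMeasure P (⋃ l : ℕ, {X | X l ∉ A}) = 0 := by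
      refine measure_iUnion_null fun l => ?_
      have hpre : {X : ℕ → Bits n | X l ∉ A} = (↑({l} : Finset ℕ) : Set ℕ).pi fun _ => {x | x ∉ A} := by
        ext X; simp
      rw [hpre, sampleMeasure, Measure.infinitePi_pi _ fun _ _ => MeasurableSet.of_discrete,
        Finset.prod_singleton, PMF.toMeasure_apply_fintype]
      refine Finset.sum_eq_zero fun x _ => ?_
      rw [Set.indicator_apply]
      split_ifs with hx
      · have := hP.2.2 x hx
        rwa [ENNReal.toReal_eq_zero_iff, or_iff_left (P.apply_ne_top x)] at this
      · rfl
    rw [h0, zero_add]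
    refine (measure_biUnion_finset_le _ _).trans ?_
    have hterm : ∀ i ∈ I, sampleMeasure P {X | ∀ l < k, X l ∈ {x | i.1 ⬝ᵥ x = i.2}} =
        (2 ^ k)⁻¹ := by
      intro i hi
      obtain ⟨v, hv, huv⟩ := (Finset.mem_filter.1 hi).2
      rw [sampleMeasure_forall_mem, hP.measure_dotProduct hv huv, ENNReal.inv_pow]
    rw [Finset.sum_congr rfl hterm, Finset.sum_const, nsmul_eq_mul]
    -- There are `2 ^ n` functionals with two values each.
    have hcard : I.card ≤ 2 ^ (n + 1) := by
      refine (Finset.card_le_univ _).trans ?_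
      simp [pow_succ]
    calc (I.card : ENNReal) * (2 ^ k)⁻¹ ≤ 2 ^ (n + 1) * (2 ^ k)⁻¹ := by
          gcongr; exact_mod_cast hcard
      _ = (2 ^ N)⁻¹ := by
          rw [hk, pow_add 2 (n + 1) N, ENNReal.mul_inv (by simp) (by simp), ← mul_assoc,
            ENNReal.mul_inv_cancel (by simp) (by simp), one_mul]
  have hsub : Uᶜ ×ˢ Set.univ ⊆ S := by
    rintro ⟨X, C⟩ ⟨hX, -⟩
    apply hS
    simp only [U, Set.mem_compl_iff, Set.mem_union, not_or, Set.mem_iUnion, not_exists,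
      Set.mem_ofPred_eq, not_not] at hX
    refine ⟨fun l _ => hX.1 l, fun v hv => ?_⟩
    by_contra hvW
    -- `f` vanishes on the differences but not at `v`, so it takes the value `f (X 0)` on every
    -- sample.
    obtain ⟨f, hfv, hfW⟩ := Submodule.exists_le_ker_of_notMem hvW
    have hf : ∀ x, f x = (fun i => f (Pi.single i 1)) ⬝ᵥ x := fun x => by
      rw [LinearMap.pi_apply_eq_sum_univ f x]
      simp only [dotProduct, smul_eq_mul, mul_comm]
      refine Finset.sum_congr rfl fun i _ => ?_
      congr 2
      ext j
      simp [Pi.single_apply, eq_comm]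
    refine hX.2 (fun i => f (Pi.single i 1), f (X 0))
      (Finset.mem_filter.2 ⟨Finset.mem_univ _, v, hv, by rwa [← hf]⟩) fun l hl => ?_
    rw [← hf]
    have h0 : f (X l + X 0) = 0 := hfW (Submodule.subset_span ⟨l, hl, rfl⟩)
    rw [map_add] at h0
    exact CharTwo.add_eq_zero.1 h0
  have : IsProbabilityMeasure (learnerMeasure P) := by
    unfold learnerMeasure; infer_instance
  refine le_trans ?_ (measureReal_mono hsub)
  rw [learnerMeasure, measureReal_prod_prod, probReal_univ, mul_one, probReal_compl_eq_one_sub hmeas]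
  have : (sampleMeasure P).real U ≤ ((2 : ℝ) ^ N)⁻¹ := by
    rw [measureReal_def]
    refine (ENNReal.toReal_mono (by simp) hU).trans ?_
    simp
  linarith

theorem two_pow_clog_inv_le {δ : ℝ} (hδ : 0 < δ) : ((2 : ℝ) ^ Nat.clog 2 ⌈1 / δ⌉₊)⁻¹ ≤ δ := by
  have h1 : (⌈1 / δ⌉₊ : ℝ) ≤ 2 ^ Nat.clog 2 ⌈1 / δ⌉₊ := by
    exact_mod_cast Nat.le_pow_clog (by norm_num) _
  have h2 := (Nat.le_ceil (1 / δ)).trans h1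
  rw [inv_le_comm₀ (by positivity) hδ]
  simpa using h2

/-! ### The outcome of the elimination on spanning samples -/

variable {X : ℕ → Bits n} {A : AffineSubspace (ZMod 2) (Bits n)} {k m : ℕ} {R : Fin m → Bits n}
  {B : Fin n → Bits n} {s : MState}

/-- Columns are differences of points of `A`; conversely they generate all differences, and these
generate the direction. -/
theorem GaussState.span_eq_direction (h : GaussState X k m R B s) (hX : Spans A k X) (hk : 0 < k) :
    Submodule.span (ZMod 2) (Set.range R) = A.direction := by
  apply le_antisymm
  · rw [Submodule.span_le]
    rintro _ ⟨j, rfl⟩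
    obtain ⟨l, hl, hR⟩ := h.isSample j
    rw [hR, ← bits_sub]
    exact AffineSubspace.vsub_mem_direction (hX.1 l hl) (hX.1 0 hk)
  · refine hX.2.trans ?_
    rw [Submodule.span_le]
    rintro _ ⟨l, hl, rfl⟩
    exact h.mem_span l hl

theorem GaussState.mem_iff (h : GaussState X k m R B s) (hX : Spans A k X) (hk : 0 < k)
    (x : Bits n) : x ∈ A ↔ x + X 0 ∈ Submodule.span (ZMod 2) (Set.range R) := by
  rw [h.span_eq_direction hX hk, ← bits_sub]
  exact (AffineSubspace.vsub_right_mem_direction_iff_mem (hX.1 0 hk) x).symm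

theorem GaussState.parametrizes (h : GaussState X k m R B s) (hX : Spans A k X) (hk : 0 < k) :
    Parametrizes (Matrix.of fun i j => R j i) (X 0) A := by
  refine ⟨h.indep, ?_⟩
  ext x
  rw [SetLike.mem_coe, h.mem_iff hX hk, Submodule.mem_span_range_iff_exists_fun]
  refine exists_congr fun b => ?_
  have : (Matrix.of fun i j => R j i).mulVec b = ∑ j, b j • R j := by
    ext i
    simp [Matrix.mulVec, dotProduct, mul_comm]
  rw [this]
  constructor
  · intro hb
    rw [hb, add_assoc, bits_add_self, add_zero]
  · intro hb
    rw [hb, add_assoc, bits_add_self, add_zero]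

theorem GaussState.isMaxIndepSubfamily (h : GaussState X k m R B s) :
    IsMaxIndepSubfamily (fun l : Fin k => X l + X 0) (Matrix.of fun i j => R j i) :=
  ⟨h.indep, fun j => by
    obtain ⟨l, hl, hR⟩ := h.isSample j
    exact ⟨⟨l, hl⟩, hR⟩, fun l => h.mem_span l l.isLt⟩

theorem GaussState.returnsParam (h : GaussState X k m R B s) (h0 : s.reg 0 = m)
    (h1 : s.reg 1 = n + n * n) : s.ReturnsParam (Matrix.of fun i j => R j i) (X 0) := by
  refine ⟨h0, fun i => ?_, fun i j => ?_⟩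
  · rw [h1]; exact h.base i
  · rw [h1]; exact h.cols j i

end

theorem recoversAffineSubspaces_gauss : RecoversAffineSubspaces gauss := by
  refine ⟨200 * 3 ^ 3 + 3, fun n δ hδ hδ1 => ?_⟩
  intro k s₀ T
  have hy : 1 < 1 / δ := by rwa [lt_div_iff₀ hδ, one_mul]
  have hk : k = n + 1 + Nat.clog 2 ⌈1 / δ⌉₊ := by
    simp only [k, ceil_logb_two (lt_trans one_pos hy)]
  have hrun : ∀ (X : ℕ → Bits n) (C : ℕ → Bool), ∃ s', RunsTo X C gauss s₀ T s' ∧ ∃ m R B,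
      s'.reg 0 = m ∧ s'.reg 1 = n + n * n ∧ GaussState X k m R B s' := fun X C => by
    rw [hk]
    exact ((wp_gauss (X := X) (C := C) (s := s₀) (D := ⌈1 / δ⌉₊) rfl rfl rfl rfl).le
      (poly_le_floor hy le_rfl)).runsTo
  refine ⟨fun X C => ?_, fun A P hP => ?_⟩
  · obtain ⟨s', hs', m, R, B, h0, h1, h⟩ := hrun X C
    exact ⟨s', m, _, hs', h.queries, h.returnsParam h0 h1, h.isMaxIndepSubfamily⟩
  · refine le_trans ?_ (le_measure_of_spans hP (N := Nat.clog 2 ⌈1 / δ⌉₊) fun ω hω => ?_)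
    · linarith [two_pow_clog_inv_le hδ]
    · rw [← hk] at hω
      obtain ⟨s', hs', m, R, B, h0, h1, h⟩ := hrun ω.1 ω.2
      exact ⟨s', m, _, _, hs', h.returnsParam h0 h1, h.parametrizes hω (by omega)⟩

/-! ## Clifford operators -/

/-- Normalization does the rest: the product of `r` and the number of points is `1`, which excludes
the empty subspace, and `A` has as many points as its direction. -/
theorem isUniformOn_of_const {n : ℕ} {P : PMF (Bits n)} {A : AffineSubspace (ZMod 2) (Bits n)}
    {r : ℝ} (h₁ : ∀ x ∈ A, (P x).toReal = r) (h₀ : ∀ x ∉ A, (P x).toReal = 0) :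
    IsUniformOn P A := by
  classical
  have hsum : ∑ x, (P x).toReal = 1 := by
    have h := P.tsum_coe
    rw [tsum_fintype] at h
    rw [← ENNReal.toReal_sum fun x _ => P.apply_ne_top x, h, ENNReal.toReal_one]
  have hcard : ((Finset.univ.filter fun x => x ∈ A).card : ℝ) * r = 1 := by
    rw [← hsum, ← nsmul_eq_mul, ← Finset.sum_const, Finset.sum_filter]
    refine Finset.sum_congr rfl fun x _ => ?_
    split_ifs with hx
    · exact (h₁ x hx).symm
    · exact (h₀ x hx).symm
  have hne : (Finset.univ.filter fun x => x ∈ A).Nonempty := by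
    rw [← Finset.card_pos, pos_iff_ne_zero]
    intro h
    simp [h] at hcard
  obtain ⟨p, hp⟩ := hne
  have hp : p ∈ A := by simpa using hp
  refine ⟨⟨p, hp⟩, fun x hx => ?_, h₀⟩
  have hdir : (Finset.univ.filter fun x => x ∈ A).card = 2 ^ Module.finrank (ZMod 2) A.direction := by
    rw [← Fintype.card_subtype]
    have e : A.direction ≃ {x // x ∈ A} :=
      { toFun := fun v => ⟨(v : Bits n) +ᵥ p, AffineSubspace.vadd_mem_of_mem_direction v.2 hp⟩
        invFun := fun x => ⟨(x : Bits n) -ᵥ p, AffineSubspace.vsub_mem_direction x.2 hp⟩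
        left_inv := fun v => by simp
        right_inv := fun x => by simp }
    rw [← Fintype.card_congr e, Module.card_eq_pow_finrank (K := ZMod 2), ZMod.card]
  rw [h₁ x hx]
  rw [hdir] at hcard
  push_cast at hcard
  exact eq_inv_of_mul_eq_one_right hcard

theorem neg_one_pow_val_add (s t : ZMod 2) :
    (-1 : ℂ) ^ (s + t).val = (-1) ^ s.val * (-1) ^ t.val := by
  have h : ∀ u : ZMod 2, u = 0 ∨ u = 1 := by decide
  have h1 : (1 : ZMod 2).val = 1 := rfl
  rcases h s with rfl | rfl <;> rcases h t with rfl | rfl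
  all_goals simp [h1, CharTwo.add_self_eq_zero]

section

variable {n : ℕ}

theorem one_mem_cliffordOps : (1 : QOp n) ∈ cliffordOps n :=
  ⟨one_mem _, fun M hM => by simpa using hM⟩

theorem mul_mem_cliffordOps {U V : QOp n} (hU : U ∈ cliffordOps n) (hV : V ∈ cliffordOps n) :
    U * V ∈ cliffordOps n := by
  refine ⟨mul_mem hU.1 hV.1, fun M hM => ?_⟩
  have := hU.2 _ (hV.2 M hM)
  rwa [Matrix.conjTranspose_mul, show U * V * M * (V.conjTranspose * U.conjTranspose) =
    U * (V * M * V.conjTranspose) * U.conjTranspose by simp only [Matrix.mul_assoc]]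

theorem list_prod_mem_cliffordOps {L : List (QOp n)} (h : ∀ U ∈ L, U ∈ cliffordOps n) :
    L.prod ∈ cliffordOps n := by
  induction L with
  | nil => exact one_mem_cliffordOps
  | cons U L ih =>
    rw [List.prod_cons]
    exact mul_mem_cliffordOps (h U (by simp)) (ih fun V hV => h V (by simp [hV]))

/-! ### Placed gates as Kronecker products -/

namespace PlacedGate

variable {𝒢 : (k : ℕ) → Set (QOp k)} (g : PlacedGate 𝒢 n)

theorem wire_injective : Function.Injective g.wire := fun i j h => by
  have := congrArg Fin.val h
  simp only [wire] at this
  exact Fin.ext (by omega)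

open Classical in
/-- The qubits of the line: those of the gate and the others. -/
noncomputable def wireEquiv : Fin g.width ⊕ ↥(g.supportᶜ) ≃ Fin n :=
  ((Equiv.ofInjective g.wire g.wire_injective).sumCongr (Equiv.refl _)).trans
    (Equiv.Set.sumCompl g.support)

/-- Bit strings, split into the bits of the gate and the others. -/
noncomputable def splitEquiv : Bits n ≃ Bits g.width × (↥(g.supportᶜ) → ZMod 2) :=
  (g.wireEquiv.arrowCongr (Equiv.refl (ZMod 2))).symm.trans (Equiv.sumArrowEquivProdArrow _ _ _)

theorem splitEquiv_fst (x : Bits n) (i : Fin g.width) : (g.splitEquiv x).1 i = x (g.wire i) := rfl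

theorem splitEquiv_snd (x : Bits n) (q : ↥(g.supportᶜ)) : (g.splitEquiv x).2 q = x q := by
  classical
  exact congrArg x (Equiv.Set.sumCompl_apply_inr g.support q)

theorem splitEquiv_add (x y : Bits n) : g.splitEquiv (x + y) = g.splitEquiv x + g.splitEquiv y := by
  refine Prod.ext (funext fun i => ?_) (funext fun q => ?_)
  · simp [splitEquiv_fst]
  · simp [splitEquiv_snd]

theorem dotProduct_splitEquiv [Fintype ↥(g.supportᶜ)] (x y : Bits n) : x ⬝ᵥ y =
    (g.splitEquiv x).1 ⬝ᵥ (g.splitEquiv y).1 + (g.splitEquiv x).2 ⬝ᵥ (g.splitEquiv y).2 := by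
  rw [dotProduct, ← Equiv.sum_comp g.wireEquiv, Fintype.sum_sum_type]
  rfl

open Kronecker in
theorem toOp_eq [DecidableEq (↥(g.supportᶜ) → ZMod 2)] :
    g.toOp = (g.op ⊗ₖ (1 : Matrix (↥(g.supportᶜ) → ZMod 2) (↥(g.supportᶜ) → ZMod 2) ℂ)).submatrix
      g.splitEquiv g.splitEquiv := by
  ext x y
  have h : (∀ q ∉ g.support, x q = y q) ↔ (g.splitEquiv x).2 = (g.splitEquiv y).2 := by
    simp [funext_iff, splitEquiv_snd]
  have h' : ∀ x, (fun i => x (g.wire i)) = (g.splitEquiv x).1 :=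
    fun x => funext fun i => (g.splitEquiv_fst x i).symm
  simp only [toOp, Matrix.submatrix_apply, Matrix.kroneckerMap_apply, Matrix.one_apply, h, h',
    mul_ite, mul_one, mul_zero]

open Classical in
/-- The part of a Pauli operator on the qubits outside of the gate. -/
noncomputable def restPauli (a b : ↥(g.supportᶜ) → ZMod 2) :
    Matrix (↥(g.supportᶜ) → ZMod 2) (↥(g.supportᶜ) → ZMod 2) ℂ :=
  Matrix.of fun x y => if x = y + a then (-1 : ℂ) ^ (b ⬝ᵥ y).val else 0

open Kronecker in
theorem pauliOp_eq (a b : Bits n) : pauliOp a b =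
    (pauliOp (g.splitEquiv a).1 (g.splitEquiv b).1 ⊗ₖ
      g.restPauli (g.splitEquiv a).2 (g.splitEquiv b).2).submatrix g.splitEquiv g.splitEquiv := by
  classical
  ext x y
  have h : x = y + a ↔ (g.splitEquiv x).1 = (g.splitEquiv y).1 + (g.splitEquiv a).1 ∧
      (g.splitEquiv x).2 = (g.splitEquiv y).2 + (g.splitEquiv a).2 := by
    rw [← g.splitEquiv.apply_eq_iff_eq, splitEquiv_add, Prod.ext_iff]; rfl
  simp only [pauliOp, restPauli, Matrix.of_apply, Matrix.submatrix_apply,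
    Matrix.kroneckerMap_apply]
  rw [g.dotProduct_splitEquiv, neg_one_pow_val_add]
  by_cases h₁ : (g.splitEquiv x).1 = (g.splitEquiv y).1 + (g.splitEquiv a).1 <;>
  by_cases h₂ : (g.splitEquiv x).2 = (g.splitEquiv y).2 + (g.splitEquiv a).2 <;>
  simp [h, h₁, h₂]

-- Gates and Pauli operators both factor along the splitting of the qubits. Conjugation touches only
-- the factor on the gate's own qubits, where the Clifford property of the gate applies.
open Classical in
open Kronecker in
theorem toOp_mem_cliffordOps (g : PlacedGate cliffordOps n) : g.toOp ∈ cliffordOps n := by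
  obtain ⟨hu, hp⟩ := g.op_mem
  constructor
  · rw [Matrix.mem_unitaryGroup_iff, toOp_eq, Matrix.star_eq_conjTranspose,
      Matrix.conjTranspose_submatrix, Matrix.submatrix_mul_equiv, Matrix.conjTranspose_kronecker,
      ← Matrix.mul_kronecker_mul, ← Matrix.star_eq_conjTranspose,
      Matrix.mem_unitaryGroup_iff.1 hu]
    simp
  · rintro _ ⟨k, a, b, rfl⟩
    obtain ⟨k', a', b', h⟩ := hp _ ⟨0, (g.splitEquiv a).1, (g.splitEquiv b).1, rfl⟩
    rw [pow_zero, one_smul] at h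
    refine ⟨k + k', g.splitEquiv.symm (a', (g.splitEquiv a).2),
      g.splitEquiv.symm (b', (g.splitEquiv b).2), ?_⟩
    rw [toOp_eq, g.pauliOp_eq a b, g.pauliOp_eq (g.splitEquiv.symm _)]
    simp only [Equiv.apply_symm_apply]
    rw [Matrix.mul_smul, Matrix.smul_mul, Matrix.conjTranspose_submatrix,
      Matrix.submatrix_mul_equiv, Matrix.submatrix_mul_equiv, Matrix.conjTranspose_kronecker,
      ← Matrix.mul_kronecker_mul, ← Matrix.mul_kronecker_mul, h, Matrix.smul_kronecker, pow_add,
      mul_smul, Matrix.submatrix_smul]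
    simp

end PlacedGate

/-! ### Output distributions of Clifford circuits -/

theorem circuitOp_mem_cliffordOps (L : List (GateLayer cliffordOps n)) :
    circuitOp L ∈ cliffordOps n := by
  refine list_prod_mem_cliffordOps fun U hU => ?_
  obtain ⟨l, -, rfl⟩ := List.mem_map.1 hU
  refine list_prod_mem_cliffordOps fun V hV => ?_
  obtain ⟨g, -, rfl⟩ := List.mem_map.1 hV
  exact g.toOp_mem_cliffordOps

theorem pauliOp_zero_left (b : Bits n) :
    pauliOp 0 b = Matrix.diagonal fun x => (-1 : ℂ) ^ (b ⬝ᵥ x).val := by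
  ext x y
  rw [pauliOp, Matrix.diagonal_apply, add_zero]
  split_ifs with h
  · rw [h]
  · rfl

/-- Orthogonality of characters: if `x i = 1`, shifting `b` by the `i`-th unit vector changes the
sign of every term. -/
theorem sum_pauliOp_zero_left : ∑ b, pauliOp 0 b = (2 : ℂ) ^ n • Matrix.single (0 : Bits n) 0 1 := by
  simp only [pauliOp_zero_left]
  ext x y
  rw [Matrix.sum_apply, Matrix.smul_apply, Matrix.single_apply]
  by_cases hxy : x = y
  swap
  · rw [if_neg (by rintro ⟨rfl, rfl⟩; exact hxy rfl)]
    simp [hxy]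
  subst hxy
  simp only [Matrix.diagonal_apply_eq]
  by_cases hx : x = 0
  · subst hx
    simp
  · rw [if_neg (by rintro ⟨h, -⟩; exact hx h.symm), smul_zero]
    obtain ⟨i, hi⟩ := Function.ne_iff.1 hx
    have hi1 : x i = 1 := zmod_two_ne_zero hi
    have hval : (1 : ZMod 2).val = 1 := rfl
    have hneg : ∑ b : Bits n, (-1 : ℂ) ^ (b ⬝ᵥ x).val =
        - ∑ b : Bits n, (-1 : ℂ) ^ (b ⬝ᵥ x).val := by
      conv_lhs => rw [← Equiv.sum_comp (Equiv.addRight (Pi.single i 1))]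
      rw [← Finset.sum_neg_distrib]
      refine Finset.sum_congr rfl fun b _ => ?_
      rw [Equiv.coe_addRight, add_dotProduct, neg_one_pow_val_add, single_dotProduct, hi1]
      simp [hval]
    exact self_eq_neg.1 hneg

/-- The `M b` stabilize `U|0⟩`, and `K` collects the diagonal ones. Their phases need no analysis:
off `A` it suffices that some entry differs from `1`. -/
theorem exists_isUniformOn_of_clifford {U : QOp n} (hU : U ∈ cliffordOps n) {P : PMF (Bits n)}
    (hP : ∀ x, (P x).toReal = ‖U x 0‖ ^ 2) :
    ∃ A : AffineSubspace (ZMod 2) (Bits n), IsUniformOn P A := by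
  classical
  let M : Bits n → QOp n := fun b => U * pauliOp 0 b * U.conjTranspose
  have hunit : U.conjTranspose * U = 1 := Matrix.mem_unitaryGroup_iff'.1 hU.1
  have hMadd : ∀ b b', M (b + b') = M b * M b' := by
    intro b b'
    have : pauliOp 0 (b + b') = pauliOp 0 b * pauliOp 0 b' := by
      simp only [pauliOp_zero_left, Matrix.diagonal_mul_diagonal, add_dotProduct,
        neg_one_pow_val_add]
    simp only [M, this]
    calc U * (pauliOp 0 b * pauliOp 0 b') * U.conjTranspose
        = U * pauliOp 0 b * 1 * pauliOp 0 b' * U.conjTranspose := by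
          simp only [Matrix.mul_assoc, Matrix.one_mul]
      _ = _ := by rw [← hunit]; simp only [Matrix.mul_assoc]
  have hsum : ∀ x, ∑ b, M b x x = (2 : ℂ) ^ n * (P x).toReal := by
    intro x
    have h1 : ∑ b, M b = (2 : ℂ) ^ n • (U * Matrix.single 0 0 1 * U.conjTranspose) := by
      rw [← Matrix.smul_mul, ← Matrix.mul_smul, ← sum_pauliOp_zero_left, Matrix.mul_sum,
        Matrix.sum_mul]
    rw [← Matrix.sum_apply, h1, Matrix.smul_apply, smul_eq_mul, hP]
    congr 1
    rw [Matrix.mul_apply, Finset.sum_eq_single 0]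
    · rw [Matrix.mul_single_apply_same, mul_one, Matrix.conjTranspose_apply]
      simpa using Complex.mul_conj' (U x 0)
    · intro y _ hy
      rw [Matrix.mul_single_apply_of_ne _ _ _ _ _ hy, zero_mul]
    · simp
  let K : Set (Bits n) := {b | ∃ (k : ℕ) (c : Bits n), M b = Complex.I ^ k • pauliOp 0 c}
  -- A non-zero `X`-part moves every basis state.
  have hK : ∀ b ∉ K, ∀ x, M b x x = 0 := by
    intro b hb x
    obtain ⟨k, a, c, h⟩ := hU.2 _ ⟨0, 0, b, rfl⟩
    rw [pow_zero, one_smul] at h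
    have ha : a ≠ 0 := by rintro rfl; exact hb ⟨k, c, h⟩
    simp only [M, h]
    simp [pauliOp, ha]
  have hsq : ∀ t : ZMod 2, ((-1 : ℂ) ^ t.val) * (-1) ^ t.val = 1 := fun t => by
    rw [← neg_one_pow_val_add, CharTwo.add_self_eq_zero]; simp
  let A : AffineSubspace (ZMod 2) (Bits n) :=
    { carrier := {x | ∀ b ∈ K, M b x x = 1}
      smul_vsub_vadd_mem' := by
        intro c p₁ p₂ p₃ h₁ h₂ h₃ b hb
        have hc : ∀ c : ZMod 2, c = 0 ∨ c = 1 := by decide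
        rcases hc c with rfl | rfl
        · simpa using h₃ b hb
        have e₁ := h₁ b hb
        have e₂ := h₂ b hb
        have e₃ := h₃ b hb
        obtain ⟨k, c, h⟩ := hb
        rw [h] at e₁ e₂ e₃ ⊢
        rw [pauliOp_zero_left] at e₁ e₂ e₃ ⊢
        simp only [Matrix.smul_apply, Matrix.diagonal_apply_eq, smul_eq_mul, one_smul, vsub_eq_sub,
          vadd_eq_add, bits_sub, dotProduct_add, neg_one_pow_val_add] at e₁ e₂ e₃ ⊢
        have h23 : (-1 : ℂ) ^ (c ⬝ᵥ p₂).val = (-1) ^ (c ⬝ᵥ p₃).val :=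
          mul_left_cancel₀ (pow_ne_zero k Complex.I_ne_zero) (e₂.trans e₃.symm)
        rw [mul_assoc, h23, hsq, mul_one, e₁] }
  refine ⟨A, isUniformOn_of_const (r := (Finset.univ.filter fun b => b ∈ K).card / 2 ^ n)
    (fun x hx => ?_) fun x hx => ?_⟩
  · have h1 : ∑ b, M b x x = (Finset.univ.filter fun b => b ∈ K).card := by
      rw [Finset.card_filter]
      push_cast
      refine Finset.sum_congr rfl fun b _ => ?_
      split_ifs with hb
      · exact hx b hb
      · exact hK b hb x
    rw [hsum] at h1
    have h2 : (2 : ℝ) ^ n * (P x).toReal = (Finset.univ.filter fun b => b ∈ K).card := by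
      exact_mod_cast h1
    rw [eq_div_iff (by positivity), mul_comm, h2]
  · obtain ⟨b₀, hb₀, hne⟩ : ∃ b ∈ K, M b x x ≠ 1 := by
      by_contra! h
      exact hx h
    obtain ⟨k, c, h⟩ := hb₀
    -- Multiplication by the diagonal `M b₀` rescales each diagonal entry by `M b₀ x x`.
    have hmul : ∀ b, M (b + b₀) x x = M b x x * M b₀ x x := fun b => by
      rw [hMadd, h, pauliOp_zero_left, ← Matrix.diagonal_smul, Matrix.mul_diagonal,
        Matrix.diagonal_apply_eq]
    have h1 : ∑ b, M b x x = (∑ b, M b x x) * M b₀ x x := by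
      conv_lhs => rw [← Equiv.sum_comp (Equiv.addRight b₀)]
      rw [Finset.sum_mul]
      exact Finset.sum_congr rfl fun b _ => hmul b
    have h2 : ∑ b, M b x x = 0 := by
      by_contra h0
      exact hne (mul_left_cancel₀ h0 (by rw [mul_one, ← h1]))
    rw [hsum] at h2
    have h3 : (2 : ℝ) ^ n * (P x).toReal = 0 := by exact_mod_cast h2
    exact (mul_eq_zero.1 h3).resolve_left (by positivity)

theorem exists_isUniformOn_of_mem_cliffordDist {d : ℕ} {P : PMF (Bits n)}
    (hP : P ∈ cliffordDist n d) : ∃ A : AffineSubspace (ZMod 2) (Bits n), IsUniformOn P A := by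
  obtain ⟨L, -, hL⟩ := hP
  exact exists_isUniformOn_of_clifford (circuitOp_mem_cliffordOps L) hL

end

/-! ## Programs that represent the uniform distribution on an affine subspace -/

/-- Flip a coin for every row of the matrix, and add the selected rows to the shift. -/
def generatorTail : Prog :=
  .after [.const 3 1, .const 9 0, .add 14 4 9] (.seq vecXor (.after [.add 10 2 9, .add 12 2 9]
    (.seq (.loop 10 (.after [.flip 13, .add 14 12 9] (.seq (.ite 13 vecXor .skip)
      (block [.add 12 12 2, .sub 10 10 3])))) (.instr (.const 0 0)))))

/-- Test whether the vector at `0` lies in the affine subspace. -/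
def evaluatorTail : Prog :=
  .after [.const 3 1, .const 9 0, .add 14 4 9] (.seq vecXor (.seq reduceVec
    (.after [.sub 0 3 13, .const 1 1] (.loop 5 (block [.add 1 1 1, .sub 5 5 3])))))

/-- The sum of `t` and the rows selected by the coins. -/
def coinSum {n : ℕ} (B : Fin n → Bits n) (t : Bits n) (C : ℕ → Bool) : Bits n :=
  t + ∑ p : Fin n, if C p then B p else 0

/-- The data of an affine subspace with `m` as its dimension. -/
structure HasData {n : ℕ} (m : ℕ) (B : Fin n → Bits n) (t : Bits n) (s : MState) : Prop where
  reg2 : s.reg 2 = n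
  reg4 : s.reg 4 = n + n * n
  reg5 : s.reg 5 = m
  basis : HasMat s.mem B
  base : HasVec s.mem (n + n * n) t

section

variable {n₀ n m : ℕ} {X : ℕ → Bits n₀} {C : ℕ → Bool} {s : MState} {B : Fin n → Bits n}
  {t x : Bits n}

/-- Every row uses a coin, zero rows included, so that coin `p` decides about row `p` as in
`coinSum`. -/
theorem wp_generatorTail (h : HasData m B t s) (h0 : HasVec s.mem 0 (0 : Bits n))
    (hf : s.flips = 0) :
    wp X C generatorTail (60 * (n + 1) ^ 2) (fun s' => s'.reg 0 = 0 ∧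
      HasVec s'.mem 0 (coinSum B t C)) s := by
  refine (wp_after_of (t := ((22 * n + 5) + ((n * (22 * n + 16 + 1) + 1) + 1 + 1 + 2 * 2) + 1))
    (P := fun s' => s.Agree 3 s' ∧ s'.reg 3 = 1 ∧
      s'.reg 9 = 0 ∧ s'.reg 14 = n + n * n ∧ s'.mem = s.mem) ?_ ?_).le ?_
  · simp only [List.foldl, Instr.exec]
    exact ⟨(((MState.Agree.refl _ _).set (by norm_num)).set (by norm_num)).set (by norm_num),
      by simp, by simp, by simp [h.reg4], trivial⟩
  rotate_left
  · simp only [List.length_cons, List.length_nil]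
    nlinarith
  rintro s₁ ⟨hA₁, h3, h9, h14, hm₁⟩
  have hs₁ : s₁.Std n := ⟨(hA₁.reg 2 (by norm_num)).trans h.reg2, h3, h9⟩
  refine wp_seq_of (wp_vecXor_bits (v := 0) (w := t) hs₁ (by rwa [hm₁])
    (by rw [hm₁, h14]; exact h.base)) ?_
  rintro s₂ ⟨hA₂, hv₂, hm₂⟩
  rw [zero_add] at hv₂
  have hs₂ := hs₁.of_agree hA₂
  have hB₂ : HasMat s₂.mem B := h.basis.congr fun a ha _ => by rw [hm₂ a ha, hm₁]
  have hf₂ : s₂.flips = 0 := (hA₂.flips.trans hA₁.flips).trans hf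
  refine wp_after (wp_seq_of (t₁ := n * (22 * n + 16 + 1) + 1) (t₂ := 1)
    (wp_loop (t := 22 * n + 16) (fun j s' => s'.Std n ∧ s'.reg 10 = n - j ∧
    s'.reg 12 = n + j * n ∧ s'.flips = j ∧ HasMat s'.mem B ∧ HasVec s'.mem 0 (t + ∑ p ∈
      Finset.range j, if h : p < n then if C p then B ⟨p, h⟩ else 0 else 0)) n ?_ ?_ ?_) ?_)
  · rintro j s₃ hj ⟨hs₃, e10, e12, ef, hB₃, hv₃⟩
    refine ⟨by omega, (wp_after_of (t := 22 * n + 12) (P := fun s' => s'.Std n ∧ s'.reg 10 = n - j ∧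
      s'.reg 12 = n + j * n ∧ s'.reg 13 = (C j).toNat ∧ s'.reg 14 = n + j * n ∧ s'.flips = j + 1 ∧
      s'.mem = s₃.mem) ?_ ?_)⟩
    · simp only [List.foldl, Instr.exec, ef]
      exact ⟨⟨by simp [hs₃.reg2], by simp [hs₃.reg3], by simp [hs₃.reg9]⟩, by simp [e10],
        by simp [e12], by simp, by simp [e12, hs₃.reg9], trivial, trivial⟩
    rintro s₄ ⟨hs₄, e10, e12, e13, e14, ef, hm₄⟩
    refine wp_seq_of (t₁ := 22 * n + 6) (t₂ := 5) (P := fun s' => s₄.Agree 20 s' ∧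
      (∀ a, n ≤ a → s'.mem a = s₄.mem a) ∧ HasVec s'.mem 0 (t + ∑ p ∈
      Finset.range (j + 1), if h : p < n then if C p then B ⟨p, h⟩ else 0 else 0))
      (wp_ite (t := 22 * n + 5) (fun hc => ?_) fun hc => ?_) ?_
    · have hc : C j = true := by
        rw [e13] at hc
        cases hC : C j <;> simp [hC] at hc ⊢
      refine (wp_vecXor_bits (w := B ⟨j, hj⟩) hs₄ (by rw [hm₄]; exact hv₃)
        (by rw [hm₄, e14]; exact hB₃ ⟨j, hj⟩)).mono le_rfl ?_
      rintro s₅ ⟨hA₅, hv₅, hm₅⟩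
      refine ⟨hA₅, hm₅, ?_⟩
      rw [Finset.sum_range_succ, dif_pos hj, if_pos hc, ← add_assoc]
      exact hv₅
    · have hc : C j = false := by
        rw [e13] at hc
        cases hC : C j <;> simp [hC] at hc ⊢
      refine (wp_skip ⟨MState.Agree.refl _ _, fun _ _ => rfl, ?_⟩).le (by omega)
      rw [Finset.sum_range_succ, dif_pos hj, hc, if_neg (by simp), add_zero, hm₄]
      exact hv₃
    · rintro s₅ ⟨hA₅, hm₅, hv₅⟩
      have hs₅ := hs₄.of_agree hA₅
      have f10 := (hA₅.reg 10 (by norm_num)).trans e10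
      have f12 := (hA₅.reg 12 (by norm_num)).trans e12
      refine wp_block ?_
      simp only [List.foldl, Instr.exec]
      exact ⟨⟨by simp [hs₅.reg2], by simp [hs₅.reg3], by simp [hs₅.reg9]⟩,
        by simp [f10, hs₅.reg3]; omega, by simp [f12, hs₅.reg2]; ring, hA₅.flips.trans ef,
        hB₃.congr fun a ha _ => by rw [hm₅ a ha, hm₄], hv₅⟩
  · rintro s₃ ⟨-, e10, -⟩
    simpa using e10
  · simp only [List.foldl, Instr.exec]
    exact ⟨⟨by simp [hs₂.reg2], by simp [hs₂.reg3], by simp [hs₂.reg9]⟩,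
      by simp [hs₂.reg2, hs₂.reg9], by simp [hs₂.reg2, hs₂.reg9], hf₂, hB₂, by simpa using hv₂⟩
  · rintro s₃ ⟨-, -, -, -, -, hv₃⟩
    refine wp_instr ⟨by simp [Instr.exec], ?_⟩
    rw [Finset.sum_range] at hv₃
    simpa [Instr.exec, coinSum] using hv₃

-- Register `13` is `1` exactly if `x + t` was inserted, that is, if it is outside the span. The
-- denominator takes `m` doublings, and `m ≤ n` bounds their time.
open Classical in
theorem wp_evaluatorTail (h : HasData m B t s) (hx : HasVec s.mem 0 x) (hE : IsEchelon B)
    (hmn : m ≤ n) :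
    wp X C evaluatorTail (100 * (n + 1) ^ 2) (fun s' => s'.reg 1 = 2 ^ m ∧
      s'.reg 0 = if x + t ∈ Submodule.span (ZMod 2) (Set.range B) then 1 else 0) s := by
  refine (wp_after_of (t := (22 * n + 5) + ((36 * n * n + 40 * n + 9) +
      ((m * (5 + 1) + 1) + 2 * 2) + 1) + 1)
    (P := fun s' => s.Agree 3 s' ∧ s'.reg 3 = 1 ∧ s'.reg 5 = m ∧
      s'.reg 9 = 0 ∧ s'.reg 14 = n + n * n ∧ s'.mem = s.mem) ?_ ?_).le ?_
  · simp only [List.foldl, Instr.exec]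
    exact ⟨(((MState.Agree.refl _ _).set (by norm_num)).set (by norm_num)).set (by norm_num),
      by simp, by simp [h.reg5], by simp, by simp [h.reg4], trivial⟩
  rotate_left
  · simp only [List.length_cons, List.length_nil]
    nlinarith
  rintro s₁ ⟨hA₁, h3, h5, h9, h14, hm₁⟩
  have hs₁ : s₁.Std n := ⟨(hA₁.reg 2 (by norm_num)).trans h.reg2, h3, h9⟩
  refine wp_seq_of (wp_vecXor_bits (v := x) (w := t) hs₁ (by rwa [hm₁])
    (by rw [hm₁, h14]; exact h.base)) ?_
  rintro s₂ ⟨hA₂, hv₂, hm₂⟩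
  have hs₂ := hs₁.of_agree hA₂
  refine wp_seq_of (wp_reduceVec hs₂ hE hv₂
    (h.basis.congr fun a ha _ => by rw [hm₂ a ha, hm₁])) ?_
  rintro s₃ ⟨hA₃, ⟨v', B', hred, -, -⟩, -⟩
  have hs₃ := hs₂.of_agree hA₃
  have e5 := ((hA₃.reg 5 (by norm_num)).trans (hA₂.reg 5 (by norm_num))).trans h5
  have e13 : 1 - s₃.reg 13 = if x + t ∈ Submodule.span (ZMod 2) (Set.range B) then 1 else 0 := by
    rcases hred.result with ⟨hf, -, hmem⟩ | ⟨hf, hnot, -⟩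
    · rw [hf, if_pos hmem]
    · rw [hf, if_neg hnot]
  refine wp_after ((wp_loop (t := 5) (fun j s' => s'.reg 3 = 1 ∧ s'.reg 5 = m - j ∧
    s'.reg 1 = 2 ^ j ∧ s'.reg 0 = 1 - s₃.reg 13) m ?_ ?_ ?_).mono le_rfl ?_)
  · rintro j s₄ hj ⟨f3, f5, f1, f0⟩
    refine ⟨by omega, wp_block ?_⟩
    simp only [List.foldl, Instr.exec]
    exact ⟨by simp [f3], by simp [f5, f3]; omega, by simp [f1]; ring, by simp [f0]⟩
  · rintro s₄ ⟨-, f5, -⟩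
    simpa using f5
  · simp only [List.foldl, Instr.exec]
    exact ⟨by simp [hs₃.reg3], by simp [e5], by simp, by simp [hs₃.reg3]⟩
  · rintro s₄ ⟨-, -, f1, f0⟩
    exact ⟨f1, f0.trans e13⟩

/-! ## Programs with data -/

/-- Instructions that store `val 0, …, val (k - 1)` from the address `d` on. -/
def storeData (d k : ℕ) (val : ℕ → ℕ) : List Instr :=
  (List.range k).flatMap fun j => [.const 20 (d + j), .const 21 (val j), .store 20 21]

theorem foldl_storeData (d k : ℕ) (val : ℕ → ℕ) :
    s.Agree 20 ((storeData d k val).foldl (fun s a => a.exec X C s) s) ∧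
    ((storeData d k val).foldl (fun s a => a.exec X C s) s).mem = writeVec d k val s.mem := by
  induction k with
  | zero =>
    refine ⟨MState.Agree.refl _ _, ?_⟩
    funext a
    rw [writeVec, if_neg (by omega)]
    rfl
  | succ k ih =>
    have : storeData d (k + 1) val = storeData d k val ++
        [.const 20 (d + k), .const 21 (val k), .store 20 21] := by
      simp [storeData, List.range_succ]
    rw [this, List.foldl_append]
    set s' := (storeData d k val).foldl (fun s a => a.exec X C s) s
    simp only [List.foldl, Instr.exec]
    refine ⟨((ih.1.set (by norm_num)).set (by norm_num)).setMem, ?_⟩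
    rw [ih.2]
    funext a
    simp only [Function.update_apply, writeVec]
    by_cases ha : a = d + k
    · subst ha; simp
    · have : (d ≤ a ∧ a < d + k) ↔ (d ≤ a ∧ a < d + (k + 1)) := by omega
      simp [ha, this]

/-- The program `F`, after the data of an affine subspace have been stored. -/
def withData (n m : ℕ) (mem : ℕ → ℕ) (F : Prog) : Prog :=
  .after ([.const 2 n, .const 5 m, .const 4 (n + n * n)] ++
    storeData n (n * n + n) fun j => mem (n + j)) F

/-- The data are stored from address `n` on, so the vector at `0`, the evaluator's input or the
generator's zero vector, survives. -/
theorem wp_withData {mem : ℕ → ℕ} {F : Prog} {T : ℕ} {Q : MState → Prop} (hB : HasMat mem B)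
    (ht : HasVec mem (n + n * n) t) (hx : HasVec s.mem 0 x)
    (h : ∀ s', HasData m B t s' → HasVec s'.mem 0 x → s'.flips = s.flips → wp X C F T Q s') :
    wp X C (withData n m mem F) (T + 6 * (n + 1) ^ 2) Q s := by
  have hlen : (storeData n (n * n + n) fun j => mem (n + j)).length = 3 * (n * n + n) := by
    simp [storeData, mul_comm]
  refine (wp_after (t := T) ?_).le ?_
  rotate_right
  · simp only [List.length_append, hlen, List.length_cons, List.length_nil]
    nlinarith
  rw [List.foldl_append]
  set s₁ : MState := [Instr.const 2 n, .const 5 m, .const 4 (n + n * n)].foldl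
    (fun s a => a.exec X C s) s with hs₁
  have h2 : s₁.reg 2 = n := by simp [hs₁, Instr.exec]
  have h4 : s₁.reg 4 = n + n * n := by simp [hs₁, Instr.exec]
  have h5 : s₁.reg 5 = m := by simp [hs₁, Instr.exec]
  have hm : s₁.mem = s.mem := rfl
  have hf : s₁.flips = s.flips := rfl
  obtain ⟨hA, hmem⟩ := foldl_storeData (X := X) (C := C) (s := s₁) n (n * n + n)
    fun j => mem (n + j)
  have hmem' : ∀ a, n ≤ a → a < n + (n * n + n) →
      (List.foldl (fun s a => a.exec X C s) s₁
        (storeData n (n * n + n) fun j => mem (n + j))).mem a = mem a := fun a ha ha' => by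
    rw [hmem, writeVec, if_pos ⟨ha, ha'⟩, Nat.add_sub_cancel' ha]
  refine h _ ⟨(hA.reg 2 (by norm_num)).trans h2, (hA.reg 4 (by norm_num)).trans h4,
    (hA.reg 5 (by norm_num)).trans h5, ?_, ?_⟩ ?_ (hA.flips.trans hf)
  · exact hB.congr fun a ha ha' => hmem' a ha (by omega)
  · exact ht.congr fun a ha ha' => hmem' a (by omega) (by omega)
  · refine hx.congr fun a _ ha => ?_
    rw [hmem, writeVec, if_neg (by omega), hm]

end

/-! ## The law of the generator -/

theorem map_xor_coinMeasure (c : ℕ → Bool) :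
    coinMeasure.map (fun C i => C i ^^ c i) = coinMeasure := by
  unfold coinMeasure
  rw [Measure.infinitePi_map_pi (f := fun i b => b ^^ c i) _ fun i => measurable_of_finite _]
  congr 1
  funext i
  rw [PMF.toMeasure_map _ (PMF.uniformOfFintype Bool) (measurable_of_finite _)]
  congr 1
  ext b
  rw [PMF.map_apply, tsum_fintype, Fintype.sum_bool]
  cases b <;> cases c i <;> simp

section

variable {n m : ℕ} {B : Fin n → Bits n} {t : Bits n} {P : PMF (Bits n)}
  {A : AffineSubspace (ZMod 2) (Bits n)}

theorem coinSum_xor (C c : ℕ → Bool) :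
    coinSum B t (fun i => C i ^^ c i) = coinSum B t C + (coinSum B t c + t) := by
  have h : ∑ p : Fin n, (if (C p ^^ c p) = true then B p else 0) =
      ∑ p : Fin n, (if C p = true then B p else 0) + ∑ p : Fin n, if c p = true then B p else 0 := by
    rw [← Finset.sum_add_distrib]
    refine Finset.sum_congr rfl fun p _ => ?_
    cases C p <;> cases c p <;> simp [bits_add_self]
  rw [coinSum, coinSum, coinSum, h, add_right_comm t _ t, bits_add_self, zero_add, add_assoc]

theorem measurable_coinSum : Measurable (coinSum B t) := by
  have h : Measurable fun (C : ℕ → Bool) (p : Fin n) => C p :=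
    measurable_pi_lambda _ fun p => measurable_pi_apply (p : ℕ)
  exact (measurable_of_finite fun b : Fin n → Bool =>
    t + ∑ p, if b p = true then B p else 0).comp h

theorem exists_coinSum_eq {x : Bits n}
    (hx : x + t ∈ Submodule.span (ZMod 2) (Set.range B)) : ∃ c, coinSum B t c = x := by
  obtain ⟨b, hb⟩ := (Submodule.mem_span_range_iff_exists_fun _).1 hx
  refine ⟨fun i => if h : i < n then b ⟨i, h⟩ == 1 else false, ?_⟩
  have h01 : ∀ a : ZMod 2, a = 0 ∨ a = 1 := by decide
  have : ∀ p : Fin n, (if (if h : (p : ℕ) < n then b ⟨p, h⟩ == 1 else false) = true then B p else 0) =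
      b p • B p := by
    intro p
    rw [dif_pos p.isLt]
    rcases h01 (b p) with h | h <;> simp [h]
  rw [coinSum, Finset.sum_congr rfl fun p _ => this p, hb, add_comm x, ← add_assoc,
    bits_add_self, zero_add]

theorem coinSum_add_mem (C : ℕ → Bool) :
    coinSum B t C + t ∈ Submodule.span (ZMod 2) (Set.range B) := by
  rw [coinSum, add_right_comm, bits_add_self, zero_add]
  refine Submodule.sum_mem _ fun p _ => ?_
  split_ifs
  · exact Submodule.subset_span ⟨p, rfl⟩
  · exact Submodule.zero_mem _

theorem IsUniformOn.unique {P Q : PMF (Bits n)} (hP : IsUniformOn P A) (hQ : IsUniformOn Q A) :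
    P = Q := by
  ext x
  rw [← ENNReal.toReal_eq_toReal_iff' (P.apply_ne_top _) (Q.apply_ne_top _)]
  by_cases hx : x ∈ A
  · rw [hP.2.1 x hx, hQ.2.1 x hx]
  · rw [hP.2.2 x hx, hQ.2.2 x hx]

/-- Choose coins `c` with output `x`. Xor with `c` preserves the law of the coins and exchanges the
outputs `t` and `x`, so every point of `A` has the mass of `t`. The rows need not be independent. -/
theorem coinMeasure_coinSum (hP : IsUniformOn P A)
    (hA : ∀ x, x ∈ A ↔ x + t ∈ Submodule.span (ZMod 2) (Set.range B)) (x : Bits n) :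
    coinMeasure {C | coinSum B t C = x} = P x := by
  have : IsProbabilityMeasure (coinMeasure.map (coinSum B t)) :=
    Measure.isProbabilityMeasure_map measurable_coinSum.aemeasurable
  set Q := (coinMeasure.map (coinSum B t)).toPMF with hQ
  have hQx : ∀ x, Q x = coinMeasure {C | coinSum B t C = x} := fun x => by
    rw [hQ, Measure.toPMF_apply, Measure.map_apply measurable_coinSum (measurableSet_singleton x)]
    rfl
  suffices IsUniformOn Q A by rw [← hQx, this.unique hP]
  refine isUniformOn_of_const (r := (Q t).toReal) (fun x hx => ?_) fun x hx => ?_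
  · obtain ⟨c, hc⟩ := exists_coinSum_eq ((hA x).1 hx)
    rw [hQx, hQx]
    congr 1
    have hmeas : Measurable fun (C : ℕ → Bool) i => C i ^^ c i :=
      measurable_pi_lambda _ fun i =>
        (measurable_of_finite fun b : Bool => b ^^ c i).comp (measurable_pi_apply i)
    conv_lhs => rw [← map_xor_coinMeasure c]
    rw [Measure.map_apply hmeas (show MeasurableSet {C | coinSum B t C = x} from
      measurable_coinSum (measurableSet_singleton x))]
    congr 1
    ext C
    change coinSum B t (fun i => C i ^^ c i) = x ↔ coinSum B t C = t
    rw [coinSum_xor, hc, ← add_assoc, add_right_comm, add_eq_right, ← bits_sub, sub_eq_zero]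
  · have : {C | coinSum B t C = x} = ∅ := by
      ext C
      simp only [Set.mem_ofPred_eq, Set.mem_empty_iff_false, iff_false]
      rintro rfl
      exact hx ((hA _).2 (coinSum_add_mem C))
    rw [hQx, this, measure_empty, ENNReal.toReal_zero]

variable {mem : ℕ → ℕ}

theorem isGenerator_withData (hB : HasMat mem B) (ht : HasVec mem (n + n * n) t)
    (hP : IsUniformOn P A)
    (hA : ∀ x, x ∈ A ↔ x + t ∈ Submodule.span (ZMod 2) (Set.range B)) :
    IsGenerator n (106 * (n + 1) ^ 106) (withData n m mem generatorTail) P := by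
  have hrun : ∀ C : ℕ → Bool, ∃ s', RunsTo noSamples C (withData n m mem generatorTail)
      (.start (regsOf []) 0) (106 * (n + 1) ^ 106) s' ∧ s'.reg 0 = 0 ∧
        HasVec s'.mem 0 (coinSum B t C) := fun C => by
    have h0 : HasVec (MState.start (regsOf []) 0).mem 0 (0 : Bits n) := fun i => rfl
    refine ((wp_withData (m := m) hB ht h0 fun s' hd hx hf => wp_generatorTail hd hx hf).le
      ?_).runsTo
    have : (n + 1) ^ 2 ≤ (n + 1) ^ 106 := Nat.pow_le_pow_right (by omega) (by norm_num)
    omega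
  refine ⟨fun C => (hrun C).imp fun s' h => h.1, fun x => ?_⟩
  rw [← coinMeasure_coinSum hP hA x]
  congr 1
  ext C
  obtain ⟨s', hs', h0, hv⟩ := hrun C
  constructor
  · rintro ⟨s'', hs'', h⟩
    obtain rfl := hs'.unique hs''
    funext i
    apply ZMod.val_injective
    rw [← hv i, ← h i, h0]
  · intro hx
    refine ⟨s', hs', fun i => ?_⟩
    rw [h0, hv i, ← hx]

/-- The `106` is the `100` of `wp_evaluatorTail` plus the `6` of `wp_withData`; as an exponent it is
merely generous, one constant serving both purposes. -/
theorem isEvaluator_withData (hB : HasMat mem B) (ht : HasVec mem (n + n * n) t)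
    (hP : IsUniformOn P A) (hE : IsEchelon B) (hm : Module.finrank (ZMod 2) A.direction = m)
    (hA : ∀ x, x ∈ A ↔ x + t ∈ Submodule.span (ZMod 2) (Set.range B)) :
    IsEvaluator n (106 * (n + 1) ^ 106) (withData n m mem evaluatorTail) P := by
  intro x C
  have hmn : m ≤ n := by
    rw [← hm]
    refine (Submodule.finrank_le _).trans ?_
    simp
  have hx : HasVec (MState.start (regsOf []) (bitSeq x)).mem 0 x := fun i => by
    simp [MState.start, bitSeq]
  obtain ⟨s', hs', h1, h0⟩ := ((wp_withData (m := m) (X := noSamples) (C := C) hB ht hx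
    fun s' hd hx _ => wp_evaluatorTail hd hx hE hmn).le (by
      have : (n + 1) ^ 2 ≤ (n + 1) ^ 106 := Nat.pow_le_pow_right (by omega) (by norm_num)
      omega : _ ≤ 106 * (n + 1) ^ 106)).runsTo
  refine ⟨s', hs', by rw [h1]; positivity, ?_⟩
  rw [h1, h0]
  by_cases hxA : x ∈ A
  · rw [if_pos ((hA x).1 hxA), hP.2.1 x hxA, hm]
    simp
  · rw [if_neg (mt (hA x).2 hxA), hP.2.2 x hxA]
    simp

end

/-! ## Writing programs -/

/-- The numbers of the list `l` are stored from the address `d` on. -/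
def HasList (mem : ℕ → ℕ) (d : ℕ) (l : List ℕ) : Prop :=
  ∀ i (h : i < l.length), mem (d + i) = l[i]

/-- Write constants and contents of registers to the address in register `10`. -/
def emit : List (ℕ ⊕ ℕ) → List Instr :=
  List.flatMap (Sum.elim (fun c => [.const 20 c, .store 10 20, .add 10 10 3])
    fun r => [.store 10 r, .add 10 10 3])

/-- The list `l` has been written from the address `d` on; the memory before `d` and the registers
below `10` are those of `s₀`. -/
structure Emitted (s₀ : MState) (d : ℕ) (l : List ℕ) (s : MState) : Prop where
  reg : ∀ i < 10, s.reg i = s₀.reg i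
  reg10 : s.reg 10 = d + l.length
  mem : ∀ a < d, s.mem a = s₀.mem a
  list : HasList s.mem d l

section

variable {n₀ : ℕ} {X : ℕ → Bits n₀} {C : ℕ → Bool} {s₀ s : MState} {d : ℕ} {l : List ℕ}

/-- The new registers are left general to cover both kinds of item: constants pass through register
`20`, contents of registers do not. -/
theorem Emitted.snoc (h : Emitted s₀ d l s) (h3 : s₀.reg 3 = 1) {reg : ℕ → ℕ} {v : ℕ}
    {buf : ℕ → ℕ} {q f : ℕ} (hreg : ∀ i, i ≠ 10 → i ≠ 20 → reg i = s.reg i)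
    (h10 : reg 10 = s.reg 10 + s.reg 3) :
    Emitted s₀ d (l ++ [v]) ⟨reg, Function.update s.mem (s.reg 10) v, buf, q, f⟩ := by
  refine ⟨fun i hi => (hreg i (by omega) (by omega)).trans (h.reg i hi), ?_, fun a ha => ?_,
    fun i hi => ?_⟩
  · change reg 10 = _
    rw [h10, h.reg10, h.reg 3 (by norm_num), h3, List.length_append]
    rfl
  · have := h.reg10
    have hne : a ≠ s.reg 10 := by omega
    simpa [hne] using h.mem a ha
  · rw [List.length_append, List.length_singleton] at hi
    rw [h.reg10]
    by_cases hil : i < l.length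
    · have hne : i ≠ l.length := hil.ne
      simpa [hne, hil] using h.list i hil
    · obtain rfl : i = l.length := by omega
      simp

theorem Emitted.emit (h3 : s₀.reg 3 = 1) (items : List (ℕ ⊕ ℕ)) {s : MState} {l : List ℕ}
    (h : Emitted s₀ d l s) (hitems : ∀ r, Sum.inr r ∈ items → r ≠ 10 ∧ r ≠ 20) :
    Emitted s₀ d (l ++ items.map (Sum.elim id s.reg))
      ((emit items).foldl (fun s a => a.exec X C s) s) ∧
    ∀ i, i ≠ 10 → i ≠ 20 → ((emit items).foldl (fun s a => a.exec X C s) s).reg i = s.reg i := by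
  induction items generalizing s l with
  | nil => simpa [_root_.emit] using h
  | cons a items ih =>
    have hitems' : ∀ r, Sum.inr r ∈ items → r ≠ 10 ∧ r ≠ 20 := fun r hr =>
      hitems r (List.mem_cons_of_mem _ hr)
    rw [_root_.emit, List.flatMap_cons, List.foldl_append, ← _root_.emit]
    set s₁ : MState := List.foldl (fun s a => a.exec X C s) s (Sum.elim (fun c =>
      [Instr.const 20 c, .store 10 20, .add 10 10 3]) (fun r => [.store 10 r, .add 10 10 3]) a)
      with hs₁
    have hreg : ∀ i, i ≠ 10 → i ≠ 20 → s₁.reg i = s.reg i := fun i h1 h2 => by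
      rcases a with c | r <;> simp [hs₁, Instr.exec, h1, h2]
    have h₁ : Emitted s₀ d (l ++ [Sum.elim id s.reg a]) s₁ := by
      rcases a with c | r
      · have := h.snoc h3 (reg := s₁.reg) (v := c) (buf := s.buf) (q := s.queries) (f := s.flips)
          hreg (by simp [hs₁, Instr.exec])
        simpa [hs₁, Instr.exec] using this
      · have := h.snoc h3 (reg := s₁.reg) (v := s.reg r) (buf := s.buf) (q := s.queries)
          (f := s.flips) hreg (by simp [hs₁, Instr.exec])
        simpa [hs₁, Instr.exec] using this
    obtain ⟨h₂, h₂'⟩ := ih h₁ hitems'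
    refine ⟨?_, fun i h1 h2 => (h₂' i h1 h2).trans (hreg i h1 h2)⟩
    have hmap : items.map (Sum.elim id s₁.reg) = items.map (Sum.elim id s.reg) := by
      refine List.map_congr_left fun b hb => ?_
      rcases b with c | r
      · rfl
      · exact hreg r (hitems' r hb).1 (hitems' r hb).2
    rw [hmap, List.append_assoc] at h₂
    exact h₂

theorem length_emit_le (items : List (ℕ ⊕ ℕ)) : (emit items).length ≤ 3 * items.length := by
  induction items with
  | nil => simp [emit]
  | cons a items ih =>
    rw [emit, List.flatMap_cons, ← emit, List.length_append, List.length_cons]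
    rcases a with c | r <;> simp <;> omega

theorem code_after (l : List Instr) (F : Prog) :
    (Prog.after l F).code = l.flatMap (fun a => 10 :: a.code) ++ F.code := by
  induction l with
  | nil => rfl
  | cons a l ih =>
    change 10 :: (a.code ++ (Prog.after l F).code) = _
    rw [ih, List.flatMap_cons]
    simp

/-- Write the code that stores the content of the address in register `12`. -/
def emitStore : Prog :=
  .after [.load 13 12] (block (emit [.inl 10, .inl 1, .inl 20, .inr 12, .inl 10, .inl 1, .inl 21,
    .inr 13, .inl 10, .inl 5, .inl 20, .inl 21] ++ [.add 12 12 3, .sub 11 11 3]))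

/-- Write the program `F` with the data of the affine subspace that the elimination has found, after
these data. -/
def emitWithData (F : Prog) : Prog :=
  .after ([.add 10 4 2, .add 0 10 9, .sub 11 10 2, .add 12 2 9] ++
      emit [.inl 10, .inl 1, .inl 2, .inr 2, .inl 10, .inl 1, .inl 5, .inr 5,
        .inl 10, .inl 1, .inl 4, .inr 4])
    (.seq (.loop 11 emitStore) (block (emit (F.code.map .inl))))

/-- The code is written from `d` on, right after the base point and over the columns, which are no
longer needed. The data that are read lie below `d` and stay intact. -/
theorem wp_emitWithData {n m : ℕ} (hs : s.Std n) (h4 : s.reg 4 = n + n * n) (h5 : s.reg 5 = m)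
    (F : Prog) :
    wp X C (emitWithData F) ((200 + 6 * F.code.length) * (n + 1) ^ 2)
      (fun s' => s'.ReturnsCode (withData n m s.mem F)) s := by
  set d := n + n * n + n with hd
  -- The header and the stores of the first `j` cells; each instruction follows the opcode `10` of
  -- the sequence that contains it.
  let code : ℕ → List ℕ := fun j => [10, 1, 2, n, 10, 1, 5, m, 10, 1, 4, n + n * n] ++
    (storeData n j fun i => s.mem (n + i)).flatMap fun a => 10 :: a.code
  set s₀ : MState := [Instr.add 10 4 2, .add 0 10 9, .sub 11 10 2, .add 12 2 9].foldl
    (fun s a => a.exec X C s) s with hs₀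
  have e0 : s₀.reg 0 = d := by simp [hs₀, Instr.exec, h4, hs.reg2, hs.reg9, hd]
  have e2 : s₀.reg 2 = n := by simp [hs₀, Instr.exec, hs.reg2]
  have e3 : s₀.reg 3 = 1 := by simp [hs₀, Instr.exec, hs.reg3]
  have e4 : s₀.reg 4 = n + n * n := by simp [hs₀, Instr.exec, h4]
  have e5 : s₀.reg 5 = m := by simp [hs₀, Instr.exec, h5]
  have e10 : s₀.reg 10 = d := by simp [hs₀, Instr.exec, h4, hs.reg2, hd]
  have e11 : s₀.reg 11 = n * n + n := by simp [hs₀, Instr.exec, h4, hs.reg2]; omega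
  have e12 : s₀.reg 12 = n := by simp [hs₀, Instr.exec, hs.reg2, hs.reg9]
  have em : s₀.mem = s.mem := rfl
  have hE₀ : Emitted s₀ d [] s₀ := ⟨fun _ _ => rfl, by simp [e10], fun _ _ => rfl,
    fun i hi => by simp at hi⟩
  have htime : ((n * n + n) * 80 + 1) + (2 * (3 * F.code.length) + 1) + 1 + 2 * 37 ≤
      (200 + 6 * F.code.length) * (n + 1) ^ 2 := by
    have : 1 ≤ (n + 1) ^ 2 := Nat.one_le_pow _ _ (by omega)
    have h1 : 6 * F.code.length ≤ 6 * F.code.length * (n + 1) ^ 2 := Nat.le_mul_of_pos_right _ this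
    rw [add_mul]
    nlinarith
  refine (wp_after ?_).le htime
  rw [List.foldl_append]
  obtain ⟨hE₁, hr₁⟩ := hE₀.emit (X := X) (C := C) e3 [.inl 10, .inl 1, .inl 2, .inr 2, .inl 10,
    .inl 1, .inl 5, .inr 5, .inl 10, .inl 1, .inl 4, .inr 4] (by simp)
  refine wp_seq_of (wp_loop (t := 79) (fun j s' => s'.reg 11 = n * n + n - j ∧ s'.reg 12 = n + j ∧
    Emitted s₀ d (code j) s') (n * n + n) ?_ ?_ ?_) ?_
  · rintro j s₁ hj ⟨f11, f12, hE⟩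
    refine ⟨by omega, (wp_after_of (t := 77) (P := fun s' => s'.reg 11 = n * n + n - j ∧
      s'.reg 12 = n + j ∧ s'.reg 13 = s.mem (n + j) ∧ Emitted s₀ d (code j) s') ?_ ?_)⟩
    · simp only [List.foldl, Instr.exec]
      refine ⟨by simp [f11], by simp [f12], ?_, fun i hi => ?_, ?_, hE.mem, hE.list⟩
      · simp only [Function.update_self, f12]
        rw [hE.mem _ (by omega), em]
      · have : i ≠ 13 := by omega
        simpa [this] using hE.reg i hi
      · simpa using hE.reg10
    rintro s₂ ⟨f11, f12, f13, hE⟩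
    refine (wp_block ?_).le ?_
    rotate_right
    · decide
    rw [List.foldl_append]
    obtain ⟨hE₃, hr₃⟩ := hE.emit (X := X) (C := C) e3 [.inl 10, .inl 1, .inl 20, .inr 12, .inl 10,
      .inl 1, .inl 21, .inr 13, .inl 10, .inl 5, .inl 20, .inl 21] (by simp)
    have hcode : code (j + 1) = code j ++
        [10, 1, 20, n + j, 10, 1, 21, s.mem (n + j), 10, 5, 20, 21] := by
      simp [code, storeData, List.range_succ, Instr.code]
    simp only [List.map_cons, List.map_nil, Sum.elim_inl, Sum.elim_inr, id, f12, f13] at hE₃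
    rw [← hcode] at hE₃
    set s₃ := List.foldl (fun s a => Instr.exec X C s a) s₂ (_root_.emit _)
    have g3 : s₃.reg 3 = 1 := (hE₃.reg 3 (by norm_num)).trans e3
    have g11 := (hr₃ 11 (by norm_num) (by norm_num)).trans f11
    have g12 := (hr₃ 12 (by norm_num) (by norm_num)).trans f12
    simp only [List.foldl, Instr.exec]
    refine ⟨by simp [g11, g3]; omega, by simp [g12, g3]; ring, fun i hi => ?_, ?_, hE₃.mem,
      hE₃.list⟩
    · have h1 : i ≠ 11 := by omega
      have h2 : i ≠ 12 := by omega
      simpa [h1, h2] using hE₃.reg i hi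
    · simpa using hE₃.reg10
  · rintro s₁ ⟨f11, -⟩
    simpa using f11
  · refine ⟨(hr₁ 11 (by norm_num) (by norm_num)).trans e11,
      (hr₁ 12 (by norm_num) (by norm_num)).trans e12, ?_⟩
    simp only [List.map_cons, List.map_nil, Sum.elim_inl, Sum.elim_inr, id, e2, e4, e5,
      List.nil_append] at hE₁
    exact hE₁
  · rintro s₁ ⟨-, -, hE⟩
    refine (wp_block ?_).le ?_
    · obtain ⟨hE₂, -⟩ := hE.emit (X := X) (C := C) e3 (F.code.map .inl) (by simp)
      have hcode : code (n * n + n) ++ (F.code.map Sum.inl).map (Sum.elim id s₁.reg) =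
          (withData n m s.mem F).code := by
        rw [withData, code_after]
        simp [code, Instr.code]
      rw [hcode] at hE₂
      intro i
      rw [hE₂.reg 0 (by norm_num), e0]
      exact hE₂.list i i.isLt
    · have := length_emit_le (F.code.map Sum.inl)
      rw [List.length_map] at this
      omega

end

/-! ## Learning -/

/-- Learn the affine subspace, and write the program `F` with its data. -/
def learner (F : Prog) : Prog :=
  .after [.const 9 0, .add 1 2 9] (.seq gauss (emitWithData F))

theorem tvDist_self {n : ℕ} (P : PMF (Bits n)) : tvDist P P = 0 := by
  simp [tvDist]

/-- Common to both kinds of representation: `hF` receives what the elimination yields on spanning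
samples. The distribution represented is then `P` itself, at distance zero. -/
theorem efficientlyLearnable_clifford {IsRep : (n T : ℕ) → Prog → PMF (Bits n) → Prop} (F : Prog)
    (hmono : ∀ {n T T' : ℕ} {R : Prog} {Q : PMF (Bits n)}, T ≤ T' → IsRep n T R Q → IsRep n T' R Q)
    (hF : ∀ {n m : ℕ} {B : Fin n → Bits n} {t : Bits n} {P : PMF (Bits n)}
      {A : AffineSubspace (ZMod 2) (Bits n)} {mem : ℕ → ℕ}, HasMat mem B →
      HasVec mem (n + n * n) t → IsUniformOn P A → IsEchelon B →
      Module.finrank (ZMod 2) A.direction = m →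
      (∀ x, x ∈ A ↔ x + t ∈ Submodule.span (ZMod 2) (Set.range B)) →
      IsRep n (106 * (n + 1) ^ 106) (withData n m mem F) P) :
    EfficientlyLearnable IsRep (fun n => ⋃ d : ℕ, cliffordDist n d) := by
  -- The elimination contributes `200`, the emission `200 + 6 * F.code.length`, and the connecting
  -- instructions `5`.
  set K := 405 + 6 * F.code.length with hK
  refine ⟨learner F, K * 3 ^ 3 + 3, fun n ε δ hε hε1 hδ hδ1 => ?_⟩
  intro s₀ T
  have hy : 1 < 1 / δ := by rwa [lt_div_iff₀ hδ, one_mul]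
  have hz : (n : ℝ) + 1 / δ ≤ n + 1 / ε + 1 / δ := by
    have : 0 < 1 / ε := by positivity
    linarith
  set k := n + 1 + Nat.clog 2 ⌈1 / δ⌉₊ with hk
  have hrun : ∀ (X : ℕ → Bits n) (C : ℕ → Bool), ∃ s', RunsTo X C (learner F) s₀ T s' ∧
      ∃ (m : ℕ) (R : Fin m → Bits n) (B : Fin n → Bits n) (s₁ : MState), GaussState X k m R B s₁ ∧
        s'.ReturnsCode (withData n m s₁.mem F) := by
    intro X C
    -- The elimination expects `⌈1 / δ⌉` in register `1`, so the learner moves it there, over `⌈1 /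
    -- ε⌉`.
    have hreg : s₀.reg 2 = ⌈1 / δ⌉₊ := rfl
    have hwp : wp X C (learner F)
        ((200 * (n + ⌈1 / δ⌉₊ + 1) ^ 3 + (200 + 6 * F.code.length) * (n + 1) ^ 2 + 1) + 2 * 2)
        (fun s' => ∃ (m : ℕ) (R : Fin m → Bits n) (B : Fin n → Bits n) (s₁ : MState),
          GaussState X k m R B s₁ ∧ s'.ReturnsCode (withData n m s₁.mem F)) s₀ := by
      refine wp_after (wp_seq_of (wp_gauss rfl ?_ rfl rfl) ?_)
      · simp [Instr.exec, hreg]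
      · rintro s₁ ⟨m, R, B, -, -, hG⟩
        exact (wp_emitWithData hG.std hG.reg4 hG.reg5 F).mono le_rfl fun s' h =>
          ⟨m, R, B, s₁, hG, h⟩
    refine (hwp.le (le_trans ?_ (poly_le_floor (K := K) (e := 3) hy hz))).runsTo
    have h1 : (n + 1) ^ 2 ≤ (n + ⌈1 / δ⌉₊ + 1) ^ 3 :=
      (Nat.pow_le_pow_left (by omega) 2).trans (Nat.pow_le_pow_right (by omega) (by norm_num))
    have h2 : 1 ≤ (n + ⌈1 / δ⌉₊ + 1) ^ 3 := Nat.one_le_pow _ _ (by omega)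
    have h3 := Nat.mul_le_mul_left (200 + 6 * F.code.length) h1
    have h4 : K * (n + ⌈1 / δ⌉₊ + 1) ^ 3 = (200 + 6 * F.code.length) * (n + ⌈1 / δ⌉₊ + 1) ^ 3 +
        205 * (n + ⌈1 / δ⌉₊ + 1) ^ 3 := by rw [hK]; ring
    omega
  refine ⟨fun X C => (hrun X C).imp fun s' h => h.1, fun P hP => ?_⟩
  obtain ⟨d, hd⟩ := Set.mem_iUnion.1 hP
  obtain ⟨A, hA⟩ := exists_isUniformOn_of_mem_cliffordDist hd
  refine le_trans ?_ (le_measure_of_spans hA (N := Nat.clog 2 ⌈1 / δ⌉₊) fun ω hω => ?_)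
  · linarith [two_pow_clog_inv_le hδ]
  · rw [← hk] at hω
    have hk0 : 0 < k := by omega
    obtain ⟨s', hs', m, R, B, s₁, hG, hcode⟩ := hrun ω.1 ω.2
    refine ⟨s', _, P, hs', hcode, hmono ?_ (hF hG.basis hG.base hA hG.ech ?_ fun x => ?_), ?_⟩
    · gcongr <;> omega
    · rw [← hG.span_eq_direction hω hk0, finrank_span_eq_card hG.indep, Fintype.card_fin]
    · rw [hG.span_eq]
      exact hG.mem_iff hω hk0 x
    · rwa [tvDist_self]

/-! ### Larger time budgets -/

theorem RunsTo.mono {n T T' : ℕ} {X : ℕ → Bits n} {C : ℕ → Bool} {p : Prog} {s s' : MState}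
    (h : RunsTo X C p s T s') (hT : T ≤ T') : RunsTo X C p s T' s' := by
  obtain ⟨d, rfl⟩ := Nat.exists_eq_add_of_le' hT
  rw [RunsTo, Function.iterate_add_apply, h, stepM_iterate_halted]

/-- Every run has already halted within `T`, so by determinism the larger budget reaches the same
final states and the output events coincide. -/
theorem IsGenerator.mono {n T T' : ℕ} {R : Prog} {Q : PMF (Bits n)} (hT : T ≤ T')
    (h : IsGenerator n T R Q) : IsGenerator n T' R Q := by
  refine ⟨fun C => (h.1 C).imp fun s' hs => hs.mono hT, fun x => ?_⟩
  rw [← h.2 x]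
  congr 1
  ext C
  obtain ⟨s₁, h₁⟩ := h.1 C
  constructor
  · rintro ⟨s', hs', hx⟩
    obtain rfl := (h₁.mono hT).unique hs'
    exact ⟨s₁, h₁, hx⟩
  · rintro ⟨s', hs', hx⟩
    exact ⟨s', hs'.mono hT, hx⟩

theorem IsEvaluator.mono {n T T' : ℕ} {R : Prog} {Q : PMF (Bits n)} (hT : T ≤ T')
    (h : IsEvaluator n T R Q) : IsEvaluator n T' R Q := fun x C =>
  (h x C).imp fun _ hs => ⟨hs.1.mono hT, hs.2⟩

theorem theorem1 :
    EfficientlyLearnable IsGenerator (fun n => ⋃ d : ℕ, cliffordDist n d) ∧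
    EfficientlyLearnable IsEvaluator (fun n => ⋃ d : ℕ, cliffordDist n d) ∧
    (∀ (n d : ℕ), ∀ P ∈ cliffordDist n d,
      ∃ A : AffineSubspace (ZMod 2) (Bits n), IsUniformOn P A) ∧
    (∃ G : Prog, RecoversAffineSubspaces G) :=
  ⟨efficientlyLearnable_clifford generatorTail IsGenerator.mono
      fun hB ht hP _ _ hA => isGenerator_withData hB ht hP hA,
    efficientlyLearnable_clifford evaluatorTail IsEvaluator.mono
      fun hB ht hP hE hm hA => isEvaluator_withData hB ht hP hE hm hA,
    fun _ _ _ hP => exists_isUniformOn_of_mem_cliffordDist hP,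
    gauss, recoversAffineSubspaces_gauss⟩
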